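/- Let $\alpha$ be a finite positive Borel measure on $[-1,1]$, absolutely continuous with respect to Lebesgue measure $\lambda_1$, and let $N\ge 1$ be an integer. Call a set $D\subsetneq\mathbb C$ admissible if it is open, connected, simply connected, symmetric with respect to the real axis ($z\in D\iff\bar z\in D$) and contains $[-1,1]$. For an admissible $D$ put $$\delta_D:=\sup_{x\in[-1,1]}\ \inf\{|x-z|: z\in\mathbb C\setminus D\}.$$ For nodes $-1\le x_1<\dots<x_n\le 1$ and positive integers $k_1,\dots,k_n$ let $\mathcal F_+(D;X;\mathcal K)$ be the set of holomorphic functions $f$ from $D$ to the open unit disk with $f^{(l)}(x_j)=0$ for $0\le l\le k_j-1$, $1\le j\le n$, that are real and nonnegative on $D\cap\mathbb R$. Put $$J_+(D;X;\mathcal K):=\sup\Big\{\Big|\int_{-1}^1 g\,d\alpha\Big| : g\in\mathcal F_+(D;X;\mathcal K)\Big\},$$ and let $J_+(D;N)$ be the infimum of $J_+(D;X;\mathcal K)$ over all $n$, all nodes $-1\le x_1<\dots<x_n\le1$ and all positive integers $k_1,\dots,k_n$ with $k_1+\dots+k_n=N$. Finally let $\omega(\delta,\alpha):=\sup\{\alpha(A):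 A\subset[-1,1]\text{ Borel},\ \lambda_1(A)\le\delta\}$. Then for every admissible $D$, with $L=1/4$, $$J_+(D;N)\ \ge\ \sup_{\varepsilon>0}\left\{\left(\frac{\exp(2L\varepsilon/\delta_D)-1}{\exp(2L\varepsilon/\delta_D)+1}\right)^{2N}\big(\alpha([-1,1])-\omega(2N\varepsilon,\alpha)\big)\right\}$$ where the supremum is finite and the fraction equals $\tanh(L\varepsilon/\delta_D)$; if $D$ is moreover convex, the same holds with $L=1/2$. Moreover, for fixed $\alpha$ and $N$, $J_+(D;N)\to\alpha([-1,1])$ as $\delta_D\to0$, uniformly over admissible domains: for every $\eta>0$ there is $\rho>0$ such that $|J_+(D;N)-\alpha([-1,1])|<\eta$ for every admissible $D$ with $\delta_D<\rho$. -/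

import Mathlib

open Set Filter Topology MeasureTheory

noncomputable section

/-- A simply connected domain `D ≠ ℂ`, symmetric with respect to the real axis and
containing the segment `[-1,1]`. -/
structure IsNiceDomain (D : Set ℂ) : Prop where
  isOpen : IsOpen D
  isConnected : IsConnected D
  isSimplyConnected : IsSimplyConnected D
  symmetric : ∀ z : ℂ, z ∈ D ↔ (starRingEnd ℂ) z ∈ D
  ne_univ : D ≠ univ
  segment_subset : ∀ x : ℝ, x ∈ Icc (-1 : ℝ) 1 → (x : ℂ) ∈ D

/-- `δ_D(z)`, the distance from `z` to the complement of `D`. -/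
def deltaAt (D : Set ℂ) (z : ℂ) : ℝ :=
  sInf {d : ℝ | ∃ w ∈ Dᶜ, d = ‖z - w‖}

/-- `δ_D`, the supremum of `δ_D(x)` over `x ∈ [-1,1]`. -/
def deltaDom (D : Set ℂ) : ℝ :=
  sSup {d : ℝ | ∃ x ∈ Icc (-1 : ℝ) 1, d = deltaAt D (x : ℂ)}

/-- The class `F(D;X;K)` of holomorphic maps from `D` to the open unit disk having a zero of
order at least `k j` at each node `x j`. -/
def classF (D : Set ℂ) {n : ℕ} (x : Fin n → ℝ) (k : Fin n → ℕ) : Set (ℂ → ℂ) :=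
  {f | DifferentiableOn ℂ f D ∧ MapsTo f D (Metric.ball 0 1) ∧
    ∀ j, ∀ l < k j, iteratedDeriv l f (x j : ℂ) = 0}

/-- The members of `F(D;X;K)` that are real on `D ∩ ℝ`. -/
def classFr (D : Set ℂ) {n : ℕ} (x : Fin n → ℝ) (k : Fin n → ℕ) : Set (ℂ → ℂ) :=
  {f ∈ classF D x k | ∀ t : ℝ, (t : ℂ) ∈ D → (f t).im = 0}

/-- The members of `F_r(D;X;K)` that are nonnegative on `D ∩ ℝ`. -/
def classFplus (D : Set ℂ) {n : ℕ} (x : Fin n → ℝ) (k : Fin n → ℕ) : Set (ℂ → ℂ) :=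
  {f ∈ classFr D x k | ∀ t : ℝ, (t : ℂ) ∈ D → 0 ≤ (f t).re}

/-- `J₊(D;X;K)`, for the measure `α`. -/
def JplusNodes (α : Measure ℝ) (D : Set ℂ) {n : ℕ} (x : Fin n → ℝ) (k : Fin n → ℕ) : ℝ :=
  sSup {v : ℝ | ∃ g ∈ classFplus D x k, v = ‖∫ t in Icc (-1 : ℝ) 1, g (t : ℂ) ∂α‖}

/-- `J₊(D;N)`, the infimum of `J₊(D;X;K)` over all systems of nodes
`-1 ≤ x₁ < … < xₙ ≤ 1` and positive multiplicities `k₁ + … + kₙ = N`. -/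
def Jplus (α : Measure ℝ) (D : Set ℂ) (N : ℕ) : ℝ :=
  sInf {v : ℝ | ∃ (n : ℕ) (x : Fin n → ℝ) (k : Fin n → ℕ),
    StrictMono x ∧ (∀ j, x j ∈ Icc (-1 : ℝ) 1) ∧ (∀ j, 0 < k j) ∧ ∑ j, k j = N ∧
    v = JplusNodes α D x k}

/-- `ω(δ,α)`, the supremum of `α(A)` over Borel sets `A ⊆ [-1,1]` of Lebesgue measure at
most `δ`. -/
def modulus (α : Measure ℝ) (δ : ℝ) : ℝ :=
  sSup {v : ℝ | ∃ A : Set ℝ, MeasurableSet A ∧ A ⊆ Icc (-1 : ℝ) 1 ∧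
    volume A ≤ ENNReal.ofReal δ ∧ v = α.real A}

/-- The set of lower bounds indexed by `ε > 0`; the base of the power is
`tanh (L * ε / δ_D)`. -/
def lowerBoundSet (L : ℝ) (α : Measure ℝ) (D : Set ℂ) (N : ℕ) : Set ℝ :=
  {v : ℝ | ∃ ε : ℝ, 0 < ε ∧
    v = ((Real.exp (2 * L * ε / deltaDom D) - 1) / (Real.exp (2 * L * ε / deltaDom D) + 1)) ^
          (2 * N) * (α.real (Icc (-1 : ℝ) 1) - modulus α (2 * N * ε))}

end

/-! Let `F` be a holomorphic map of `D` to the unit disk, real on the real axis, with `c * (1 - F ^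
2) ≤ |F'|` on `[-1,1]`. The Blaschke-type product of the factors `(F - F (x j)) / (1 - F (x j) *
F)`, raised to the powers `2 * k j`, is an admissible competitor; the even powers make it
nonnegative. Since `artanh F` moves at speed at least `c`, each factor has modulus at least `tanh (c
* ε)` at points of the segment at distance at least `ε` from its node. The points nearer to some
node form a set of length at most `2 * N * ε`, which costs at most `ω(2Nε, α)` of the mass. This
gives the bound for `J₊`.

The natural `F` is the Riemann map normalized at `0`, real by symmetry. The Koebe one-quarter
theorem bounds its hyperbolic derivative below by `1 / (4 * δ_D)`; for convex `D` a supporting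
half-plane improves `4` to `2`. No exact Riemann map is needed: a disk embedding `f` whose image
contains a disk of radius `r` close to `1` is almost symmetric, by rigidity in the Schwarz lemma,
and the symmetrization `(f z + conj (f (conj z))) / 2` loses an amount that vanishes as `r → 1`.
Thus every `c < 1 / (κ * δ_D)` is reached, and `c` then tends to that limit.

Koebe's theorem follows from a coefficient inequality for univalent `G` with `G z * G w ≠ 1`: the
images of an annulus under `G` and `1 / G` are disjoint, and their areas in the metric `|dw| / |w|`
are compared with that of a ring containing both.

The limit statement combines `J₊ ≤ α([-1,1])` with the lower bound at a fixed `ε`, for which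
absolute continuity makes `ω` small. -/

/-! ### Logarithmic area and the Koebe one-quarter theorem -/

theorem integral_Ioo_circle_eq {q : ℂ → ℂ} {R s : ℝ} (hs : 0 < s) (hsR : s < R)
    (hq : DifferentiableOn ℂ q (Metric.ball 0 R)) :
    ∫ θ in Ioo (-Real.pi) Real.pi, q (s * (Real.cos θ + Real.sin θ * Complex.I)) =
      2 * Real.pi * q 0 := by
  have hd : DiffContOnCl ℂ q (Metric.ball 0 |s|) := by
    rw [abs_of_pos hs]
    refine (hq.mono ?_).diffContOnCl
    rw [closure_ball _ hs.ne']
    exact Metric.closedBall_subset_ball hsR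
  have h1 := hd.circleAverage
  rw [Real.circleAverage_eq_integral_add (-Real.pi)] at h1
  rw [← h1, intervalIntegral.integral_comp_add_right (fun θ => q (circleMap 0 s θ)),
    ← integral_Ioc_eq_integral_Ioo, ← intervalIntegral.integral_of_le (by linarith [Real.pi_pos])]
  have h2 : (0 : ℝ) + -Real.pi = -Real.pi := by ring
  have h3 : 2 * Real.pi + -Real.pi = Real.pi := by ring
  rw [h2, h3]
  have h4 : ∀ θ : ℝ, circleMap 0 s θ = s * (Real.cos θ + Real.sin θ * Complex.I) := by
    intro θ
    simp [circleMap, Complex.exp_mul_I]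
  simp only [h4]
  rw [Complex.real_smul]
  push_cast
  rw [← mul_assoc, mul_inv_cancel₀ (by simp), one_mul]

theorem continuousOn_div_norm_sq {q : ℂ → ℂ} {a : ℝ} {A : Set ℂ} (ha : 0 < a)
    (hA : ∀ z ∈ A, a ≤ ‖z‖) (hq : ContinuousOn q A) :
    ContinuousOn (fun z => q z / ((‖z‖ ^ 2 : ℝ) : ℂ)) A := by
  refine hq.div (by fun_prop) fun z hz => ?_
  have : 0 < ‖z‖ := ha.trans_le (hA z hz)
  exact_mod_cast (pow_pos this 2).ne'

theorem isCompact_annulus (a b : ℝ) : IsCompact {z : ℂ | a ≤ ‖z‖ ∧ ‖z‖ ≤ b} := by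
  refine (isCompact_closedBall (0 : ℂ) b).of_isClosed_subset ?_ fun z hz => by simpa using hz.2
  exact (isClosed_le continuous_const continuous_norm).inter
    (isClosed_le continuous_norm continuous_const)

/-- In polar coordinates the weighted area element is `ds / s` times `dθ`, and the mean value
property evaluates each circle. -/
theorem integral_annulus_div_norm_sq {q : ℂ → ℂ} {a b R : ℝ} (ha : 0 < a) (hab : a ≤ b)
    (hbR : b < R) (hq : DifferentiableOn ℂ q (Metric.ball 0 R)) :
    ∫ z in {z : ℂ | a ≤ ‖z‖ ∧ ‖z‖ ≤ b}, q z / ((‖z‖ ^ 2 : ℝ) : ℂ) =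
      2 * Real.pi * Real.log (b / a) * q 0 := by
  set A : Set ℂ := {z : ℂ | a ≤ ‖z‖ ∧ ‖z‖ ≤ b} with hA
  have hAm : MeasurableSet A := (isCompact_annulus a b).measurableSet
  rw [← integral_indicator hAm, ← Complex.integral_comp_polarCoord_symm]
  have key : ∀ p ∈ polarCoord.target,
      p.1 • A.indicator (fun z => q z / ((‖z‖ ^ 2 : ℝ) : ℂ)) (Complex.polarCoord.symm p) =
      (Icc a b ×ˢ Ioo (-Real.pi) Real.pi).indicator (fun p : ℝ × ℝ =>
        ((p.1 : ℂ))⁻¹ * q (p.1 * (Real.cos p.2 + Real.sin p.2 * Complex.I))) p := by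
    rintro ⟨s, θ⟩ ⟨hs, hθ⟩
    have hs' : 0 < s := hs
    have hn : ‖Complex.polarCoord.symm (s, θ)‖ = s := by
      rw [Complex.norm_polarCoord_symm, abs_of_pos hs']
    by_cases h : s ∈ Icc a b
    · rw [indicator_of_mem, indicator_of_mem, hn, Complex.polarCoord_symm_apply, Complex.real_smul]
      · have : (s : ℂ) ≠ 0 := by exact_mod_cast hs'.ne'
        push_cast
        field_simp
      · exact ⟨h, hθ⟩
      · simpa only [hA, mem_ofPred_eq, hn, mem_Icc] using h
    · rw [indicator_of_notMem, indicator_of_notMem, smul_zero]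
      · exact fun h' => h h'.1
      · simpa only [hA, mem_ofPred_eq, hn, mem_Icc] using h
  rw [setIntegral_congr_fun polarCoord.open_target.measurableSet key,
    setIntegral_indicator (measurableSet_Icc.prod measurableSet_Ioo),
    inter_eq_self_of_subset_right]
  swap
  · rintro ⟨s, θ⟩ ⟨hs, hθ⟩
    exact ⟨ha.trans_le hs.1, hθ⟩
  have hcont : ContinuousOn (fun p : ℝ × ℝ =>
        ((p.1 : ℂ))⁻¹ * q (p.1 * (Real.cos p.2 + Real.sin p.2 * Complex.I)))
        (Icc a b ×ˢ Icc (-Real.pi) Real.pi) := by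
    refine ContinuousOn.mul ?_ ?_
    · refine ContinuousOn.inv₀ (by fun_prop) fun p hp => ?_
      exact_mod_cast (ha.trans_le hp.1.1).ne'
    · refine hq.continuousOn.comp (by fun_prop) fun p hp => ?_
      have : ‖((p.1 : ℂ) * (Real.cos p.2 + Real.sin p.2 * Complex.I))‖ = |p.1| := by
        rw [← Complex.polarCoord_symm_apply, Complex.norm_polarCoord_symm]
      rw [mem_ball_zero_iff, this, abs_of_pos (ha.trans_le hp.1.1)]
      exact hp.1.2.trans_lt hbR
  have hint := hcont.integrableOn_compact (μ := volume) (isCompact_Icc.prod isCompact_Icc)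
  have hint' := hint.mono_set (prod_mono_right (s := Icc a b)
    (Ioo_subset_Icc_self (a := -Real.pi) (b := Real.pi)))
  rw [Measure.volume_eq_prod] at hint' ⊢
  rw [setIntegral_prod _ hint']
  have key2 : ∀ s ∈ Icc a b, ∫ θ in Ioo (-Real.pi) Real.pi,
      ((s : ℂ))⁻¹ * q (s * (Real.cos θ + Real.sin θ * Complex.I)) =
      ((s⁻¹ : ℝ) : ℂ) * (2 * Real.pi * q 0) := by
    intro s hs
    rw [integral_const_mul, integral_Ioo_circle_eq (ha.trans_le hs.1) (hs.2.trans_lt hbR) hq]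
    push_cast
    rfl
  rw [setIntegral_congr_fun measurableSet_Icc key2, integral_mul_const, integral_complex_ofReal,
    integral_Icc_eq_integral_Ioc, ← intervalIntegral.integral_of_le hab,
    integral_inv_of_pos ha (ha.trans_le hab)]
  ring

/-- Change of variables: the real Jacobian of a holomorphic map is `‖g'‖ ^ 2`. The resulting
integrand is the same for `g` and `1 / g`. -/
theorem integral_image_inv_norm_sq {g g' : ℂ → ℂ} {A : Set ℂ} (hA : MeasurableSet A)
    (hg : ∀ z ∈ A, HasDerivAt g (g' z) z) (hinj : InjOn g A) :
    ∫ w in g '' A, (‖w‖ ^ 2)⁻¹ = ∫ z in A, ‖g' z / g z‖ ^ 2 := by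
  have hd : ∀ z ∈ A, HasFDerivWithinAt g
      ((ContinuousLinearMap.toSpanSingleton ℂ (g' z)).restrictScalars ℝ) A z :=
    fun z hz => ((hg z hz).hasFDerivAt.restrictScalars ℝ).hasFDerivWithinAt
  rw [integral_image_eq_integral_abs_det_fderiv_smul volume hA hd hinj]
  refine setIntegral_congr_fun hA fun z _ => ?_
  have hdet : ((ContinuousLinearMap.toSpanSingleton ℂ (g' z)).restrictScalars ℝ).det
      = ‖g' z‖ ^ 2 := by
    have := LinearMap.det_restrictScalars (R := ℝ) (S := ℂ) (A := ℂ)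
      (f := (ContinuousLinearMap.toSpanSingleton ℂ (g' z) : ℂ →ₗ[ℂ] ℂ))
    have h2 : LinearMap.det (ContinuousLinearMap.toSpanSingleton ℂ (g' z) : ℂ →ₗ[ℂ] ℂ) = g' z :=
      ContinuousLinearMap.det_toSpanSingleton _
    rw [h2, Algebra.norm_complex_apply, Complex.normSq_eq_norm_sq] at this
    exact this
  simp only [hdet, smul_eq_mul, norm_div, abs_of_nonneg (sq_nonneg ‖g' z‖)]
  rw [div_pow, div_eq_mul_inv]

/-- The local inverse has derivative of modulus less than `c⁻¹`, hence shrinks to `‖ψ w‖ ≤ c⁻¹ *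
‖w‖` near `0`. For injective `G` this keeps the image of `ρ ≤ ‖z‖` off the disk of radius `c * ρ`.
-/
theorem exists_preimage_of_norm_lt_mul {G : ℂ → ℂ} {U : Set ℂ} (hU : U ∈ 𝓝 (0 : ℂ))
    (hG : DifferentiableOn ℂ G U) (h0 : G 0 = 0) {c : ℝ} (hc : 0 < c) (hca : c < ‖deriv G 0‖) :
    ∃ ρ₀ > 0, ∀ ρ ≤ ρ₀, ∀ w : ℂ, ‖w‖ < c * ρ → ∃ z ∈ U, ‖z‖ < ρ ∧ G z = w := by
  have ha : deriv G 0 ≠ 0 := by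
    intro h
    rw [h, norm_zero] at hca
    exact hca.not_gt hc
  have hs : HasStrictDerivAt G (deriv G 0) 0 := (hG.analyticAt hU).hasStrictDerivAt
  have hinv := hs.to_localInverse ha
  set ψ := hs.localInverse G (deriv G 0) 0 ha with hψ
  have hψ0 : ψ (G 0) = 0 := (hs.eventually_left_inverse ha).self_of_nhds
  have hright : ∀ᶠ w in 𝓝 (G 0), G (ψ w) = w := hs.eventually_right_inverse ha
  have hlt : ‖(deriv G 0)⁻¹‖ < c⁻¹ := by
    rw [norm_inv]
    exact inv_strictAnti₀ hc hca
  have hO : ∀ᶠ w in 𝓝 (G 0), ‖ψ w - ψ (G 0)‖ ≤ c⁻¹ * ‖w - G 0‖ := by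
    have h1 := hinv.hasDerivAt.isLittleO.bound (sub_pos.2 hlt)
    filter_upwards [h1] with w hw
    calc ‖ψ w - ψ (G 0)‖ = ‖(ψ w - ψ (G 0) - (w - G 0) • (deriv G 0)⁻¹)
          + (w - G 0) • (deriv G 0)⁻¹‖ := by rw [sub_add_cancel]
      _ ≤ _ := norm_add_le _ _
      _ ≤ (c⁻¹ - ‖(deriv G 0)⁻¹‖) * ‖w - G 0‖ + ‖w - G 0‖ * ‖(deriv G 0)⁻¹‖ := by
          rw [norm_smul]; gcongr
      _ = _ := by ring
  have hmem : ∀ᶠ w in 𝓝 (G 0), ψ w ∈ U := by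
    have : Tendsto ψ (𝓝 (G 0)) (𝓝 (ψ (G 0))) := hinv.hasDerivAt.continuousAt
    rw [hψ0] at this
    exact this hU
  obtain ⟨ε, hε, hball⟩ := Metric.eventually_nhds_iff_ball.1 (hright.and (hO.and hmem))
  refine ⟨ε / c, by positivity, fun ρ hρ w hw => ?_⟩
  have hwε : w ∈ Metric.ball (G 0) ε := by
    rw [h0, mem_ball_zero_iff]
    rw [le_div_iff₀ hc] at hρ
    linarith
  obtain ⟨h1, h2, h3⟩ := hball w hwε
  refine ⟨ψ w, h3, ?_, h1⟩
  rw [hψ0, h0, sub_zero, sub_zero] at h2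
  calc ‖ψ w‖ ≤ c⁻¹ * ‖w‖ := h2
    _ < c⁻¹ * (c * ρ) := by gcongr
    _ = ρ := by field_simp

theorem integral_ring_inv_norm_sq {a b : ℝ} (ha : 0 < a) (hab : a ≤ b) :
    ∫ z in {z : ℂ | a ≤ ‖z‖ ∧ ‖z‖ ≤ b}, (‖z‖ ^ 2)⁻¹ = 2 * Real.pi * Real.log (b / a) := by
  have h := integral_annulus_div_norm_sq (q := fun _ => 1) ha hab (lt_add_one b)
    (differentiableOn_const 1)
  have h2 : ∀ z : ℂ, (1 : ℂ) / ((‖z‖ ^ 2 : ℝ) : ℂ) = (((‖z‖ ^ 2)⁻¹ : ℝ) : ℂ) := by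
    intro z; push_cast; rw [one_div]
  simp only [h2] at h
  rw [integral_complex_ofReal] at h
  rw [mul_one] at h
  exact_mod_cast h

theorem continuousOn_inv_norm_sq {a : ℝ} (ha : 0 < a) {A : Set ℂ} (hA : ∀ z ∈ A, a ≤ ‖z‖) :
    ContinuousOn (fun z : ℂ => (‖z‖ ^ 2)⁻¹) A :=
  ContinuousOn.inv₀ (by fun_prop) fun z hz => (pow_pos (ha.trans_le (hA z hz)) 2).ne'

/-- Lower bound for the logarithmic area of the image of an annulus. -/
theorem log_le_integral_norm_logDeriv_sq {G : ℂ → ℂ} (hG : DifferentiableOn ℂ G (Metric.ball 0 1))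
    (hinj : InjOn G (Metric.ball 0 1)) (h0 : G 0 = 0) (ha : deriv G 0 ≠ 0) {ρ r : ℝ} (hρ : 0 < ρ)
    (hρr : ρ ≤ r) (hr : r < 1) :
    2 * Real.pi * Real.log (r / ρ) ≤
      ∫ z in {z : ℂ | ρ ≤ ‖z‖ ∧ ‖z‖ ≤ r}, ‖deriv G z / G z‖ ^ 2 := by
  have hb : Metric.ball (0 : ℂ) 1 ∈ 𝓝 0 := Metric.ball_mem_nhds _ one_pos
  have hGz : ∀ z ∈ Metric.ball (0 : ℂ) 1, z ≠ 0 → G z ≠ 0 := fun z hz hz0 h =>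
    hz0 (hinj hz (Metric.mem_ball_self one_pos) (by rw [h, h0]))
  have hpd : DifferentiableOn ℂ (dslope G 0) (Metric.ball 0 1) :=
    (Complex.differentiableOn_dslope hb).2 hG
  have hpz : ∀ z ≠ 0, dslope G 0 z = G z / z := by
    intro z hz
    rw [dslope_of_ne _ hz, slope_def_field, h0, sub_zero, sub_zero]
  have hp0 : ∀ z ∈ Metric.ball (0 : ℂ) 1, dslope G 0 z ≠ 0 := by
    intro z hz
    by_cases hz0 : z = 0
    · rwa [hz0, dslope_same]
    · rw [hpz z hz0]
      exact div_ne_zero (hGz z hz hz0) hz0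
  have hdG : DifferentiableOn ℂ (deriv G) (Metric.ball 0 1) := hG.deriv Metric.isOpen_ball
  -- With `t = z * G' / G`, holomorphic and equal to `1` at `0`, `q = 2 * t - 1`. Then `q.re ≤ ‖t‖ ^
  -- 2` because `(t.re - 1) ^ 2 ≥ 0`, and the integral of `q` is known from `q 0 = 1`.
  set q : ℂ → ℂ := fun z => 2 * (deriv G z / dslope G 0 z) - 1 with hq
  have hqd : DifferentiableOn ℂ q (Metric.ball 0 1) :=
    ((hdG.div hpd hp0).const_mul 2).sub_const 1
  have hq0 : q 0 = 1 := by
    simp only [hq, dslope_same, div_self ha]; norm_num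
  have key := integral_annulus_div_norm_sq hρ hρr hr hqd
  rw [hq0, mul_one] at key
  set A : Set ℂ := {z : ℂ | ρ ≤ ‖z‖ ∧ ‖z‖ ≤ r} with hA
  have hAc : IsCompact A := isCompact_annulus ρ r
  have hAb : A ⊆ Metric.ball 0 1 := fun z hz => by
    rw [mem_ball_zero_iff]; exact hz.2.trans_lt hr
  have hA0 : ∀ z ∈ A, z ≠ 0 := fun z hz h => by
    have := hz.1
    rw [h, norm_zero] at this
    linarith
  have hi1 : IntegrableOn (fun z => q z / ((‖z‖ ^ 2 : ℝ) : ℂ)) A :=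
    (continuousOn_div_norm_sq hρ (fun z hz => hz.1) (hqd.continuousOn.mono hAb)).integrableOn_compact
      hAc
  have hi2 : IntegrableOn (fun z => ‖deriv G z / G z‖ ^ 2) A := by
    have hc : ContinuousOn (fun z => ‖deriv G z / G z‖ ^ 2) A :=
      ((ContinuousOn.div (hdG.continuousOn.mono hAb) (hG.continuousOn.mono hAb)
        fun z hz => hGz z (hAb hz) (hA0 z hz)).norm).pow 2
    exact hc.integrableOn_compact hAc
  have hre : ∫ z in A, (q z / ((‖z‖ ^ 2 : ℝ) : ℂ)).re = 2 * Real.pi * Real.log (r / ρ) := by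
    have h1 := Complex.reCLM.integral_comp_comm hi1
    simp only [Complex.reCLM_apply] at h1
    rw [h1, key]
    have : (2 * (Real.pi : ℂ) * (Real.log (r / ρ) : ℂ)) =
      ((2 * Real.pi * Real.log (r / ρ) : ℝ) : ℂ) := by push_cast; rfl
    rw [this, Complex.ofReal_re]
  rw [← hre]
  have hi1' : IntegrableOn (fun z => (q z / ((‖z‖ ^ 2 : ℝ) : ℂ)).re) A := hi1.re
  refine setIntegral_mono_on hi1' hi2 hAc.measurableSet fun z hz => ?_
  have hz0 := hA0 z hz
  have hzn : 0 < ‖z‖ := norm_pos_iff.2 hz0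
  rw [Complex.div_ofReal_re]
  have h3 : deriv G z / G z = (deriv G z / dslope G 0 z) / z := by
    rw [hpz z hz0]
    have := hGz z (hAb hz) hz0
    field_simp
  rw [h3, norm_div, div_pow]
  gcongr
  simp only [hq]
  set t := deriv G z / dslope G 0 z
  rw [Complex.sub_re, Complex.one_re, Complex.mul_re, ← Complex.normSq_eq_norm_sq,
    Complex.normSq_apply]
  simp only [Complex.re_ofNat, Complex.im_ofNat]
  nlinarith [sq_nonneg (t.re - 1), sq_nonneg t.im]

/-- The coefficient inequality for univalent Bieberbach–Eilenberg functions. -/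
theorem norm_deriv_le_one_of_mul_ne_one {G : ℂ → ℂ}
    (hG : DifferentiableOn ℂ G (Metric.ball 0 1)) (hinj : InjOn G (Metric.ball 0 1))
    (h0 : G 0 = 0)
    (hne : ∀ z ∈ Metric.ball (0 : ℂ) 1, ∀ w ∈ Metric.ball (0 : ℂ) 1, G z * G w ≠ 1) :
    ‖deriv G 0‖ ≤ 1 := by
  by_contra! hgt
  have ha : deriv G 0 ≠ 0 := by
    intro h; rw [h, norm_zero] at hgt; linarith
  -- The choice `1 < c < ‖G' 0‖` and `c⁻¹ < r < 1` gives `1 < r * c`; the area comparison will give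
  -- `r * c ≤ 1`.
  obtain ⟨c, hc1, hca⟩ := exists_between hgt
  obtain ⟨r, hr1, hr2⟩ := exists_between (inv_lt_one_of_one_lt₀ hc1)
  have hc0 : 0 < c := by linarith
  have hr0 : 0 < r := (inv_pos.2 hc0).trans hr1
  obtain ⟨ρ₀, hρ₀, hpre⟩ := exists_preimage_of_norm_lt_mul
    (Metric.ball_mem_nhds (0 : ℂ) one_pos) hG h0 hc0 hca
  set ρ := min ρ₀ r with hρdef
  have hρ : 0 < ρ := lt_min hρ₀ hr0
  have hρr : ρ ≤ r := min_le_right _ _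
  set m := c * ρ with hm
  have hm0 : 0 < m := by positivity
  set A : Set ℂ := {z : ℂ | ρ ≤ ‖z‖ ∧ ‖z‖ ≤ r} with hA
  have hAc : IsCompact A := isCompact_annulus ρ r
  have hAb : A ⊆ Metric.ball 0 1 := fun z hz => by
    rw [mem_ball_zero_iff]; exact hz.2.trans_lt hr2
  have hA0 : ∀ z ∈ A, z ≠ 0 := fun z hz h => by
    have := hz.1
    rw [h, norm_zero] at this
    linarith
  have hGz : ∀ z ∈ A, G z ≠ 0 := fun z hz h =>
    hA0 z hz (hinj (hAb hz) (Metric.mem_ball_self one_pos) (by rw [h, h0]))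
  have hlow : ∀ z ∈ A, m ≤ ‖G z‖ := by
    intro z hz
    by_contra! hlt
    obtain ⟨ζ, hζ, hζρ, hGζ⟩ := hpre ρ (min_le_left _ _) _ hlt
    have := hinj hζ (hAb hz) hGζ
    rw [this] at hζρ
    exact hζρ.not_ge hz.1
  -- A value of `1 / G` in the disk of radius `m` would also be a value of `G`, against `G z * G w ≠
  -- 1`.
  have hupp : ∀ z ∈ A, m ≤ ‖(G z)⁻¹‖ := by
    intro z hz
    by_contra! hlt
    obtain ⟨ζ, hζ, hζρ, hGζ⟩ := hpre ρ (min_le_left _ _) _ hlt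
    exact hne z (hAb hz) ζ hζ (by rw [hGζ, mul_inv_cancel₀ (hGz z hz)])
  have hupp' : ∀ z ∈ A, ‖G z‖ ≤ m⁻¹ := by
    intro z hz
    have := hupp z hz
    rw [norm_inv] at this
    exact (le_inv_comm₀ hm0 (norm_pos_iff.2 (hGz z hz))).1 this
  have hlow' : ∀ z ∈ A, ‖(G z)⁻¹‖ ≤ m⁻¹ := by
    intro z hz
    rw [norm_inv]
    exact inv_anti₀ hm0 (hlow z hz)
  have hmm : m ≤ m⁻¹ := by
    have hrA : (r : ℂ) ∈ A := by
      have : ‖(r : ℂ)‖ = r := by rw [Complex.norm_real, Real.norm_of_nonneg hr0.le]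
      exact ⟨by rw [this]; exact hρr, by rw [this]⟩
    exact (hlow _ hrA).trans (hupp' _ hrA)
  have hder : ∀ z ∈ A, HasDerivAt G (deriv G z) z := fun z hz =>
    (hG.differentiableAt (Metric.isOpen_ball.mem_nhds (hAb hz))).hasDerivAt
  have hder' : ∀ z ∈ A, HasDerivAt (fun z => (G z)⁻¹) (-deriv G z / G z ^ 2) z := fun z hz =>
    (hder z hz).fun_inv (hGz z hz)
  have hinjA : InjOn G A := hinj.mono hAb
  have hinjA' : InjOn (fun z => (G z)⁻¹) A := fun z hz w hw h => hinjA hz hw (inv_injective h)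
  have hI1 := integral_image_inv_norm_sq hAc.measurableSet hder hinjA
  have hI2 := integral_image_inv_norm_sq hAc.measurableSet hder' hinjA'
  have hI2' : ∫ w in (fun z => (G z)⁻¹) '' A, (‖w‖ ^ 2)⁻¹ = ∫ z in A, ‖deriv G z / G z‖ ^ 2 := by
    rw [hI2]
    refine setIntegral_congr_fun hAc.measurableSet fun z hz => ?_
    have : -deriv G z / G z ^ 2 / (G z)⁻¹ = -(deriv G z / G z) := by
      have := hGz z hz
      field_simp
    simp only [this, norm_neg]
  have hcomp1 : IsCompact (G '' A) := hAc.image_of_continuousOn fun z hz =>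
    (hder z hz).continuousAt.continuousWithinAt
  have hcomp2 : IsCompact ((fun z => (G z)⁻¹) '' A) := hAc.image_of_continuousOn fun z hz =>
    (hder' z hz).continuousAt.continuousWithinAt
  set T : Set ℂ := {z : ℂ | m ≤ ‖z‖ ∧ ‖z‖ ≤ m⁻¹} with hT
  have hsub1 : G '' A ⊆ T := by
    rintro _ ⟨z, hz, rfl⟩; exact ⟨hlow z hz, hupp' z hz⟩
  have hsub2 : (fun z => (G z)⁻¹) '' A ⊆ T := by
    rintro _ ⟨z, hz, rfl⟩; exact ⟨hupp z hz, hlow' z hz⟩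
  have hdisj : Disjoint (G '' A) ((fun z => (G z)⁻¹) '' A) := by
    rw [disjoint_left]
    rintro _ ⟨z, hz, rfl⟩ ⟨w, hw, h⟩
    refine hne z (hAb hz) w (hAb hw) ?_
    rw [← h]
    exact inv_mul_cancel₀ (hGz w hw)
  have hTi : IntegrableOn (fun w : ℂ => (‖w‖ ^ 2)⁻¹) T :=
    (continuousOn_inv_norm_sq hm0 fun z hz => hz.1).integrableOn_compact (isCompact_annulus m m⁻¹)
  -- Two disjoint sets, each of logarithmic area at least `2π log (r / ρ)`, lie in a ring of
  -- logarithmic area `2π log (m⁻¹ / m)`. With `m = c * ρ` the radius `ρ` cancels.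
  have hle : ∫ w in G '' A ∪ (fun z => (G z)⁻¹) '' A, (‖w‖ ^ 2)⁻¹ ≤ ∫ w in T, (‖w‖ ^ 2)⁻¹ := by
    refine setIntegral_mono_set hTi (Eventually.of_forall fun w => ?_)
      (union_subset hsub1 hsub2).eventuallyLE
    simp only [Pi.zero_apply]
    positivity
  rw [setIntegral_union hdisj hcomp2.measurableSet (hTi.mono_set hsub1) (hTi.mono_set hsub2), hI1,
    hI2', integral_ring_inv_norm_sq hm0 hmm] at hle
  have hge := log_le_integral_norm_logDeriv_sq hG hinj h0 ha hρ hρr hr2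
  have hlog : Real.log (r / ρ) + Real.log (r / ρ) ≤ Real.log (m⁻¹ / m) := by
    have h2 : 2 * Real.pi * (Real.log (r / ρ) + Real.log (r / ρ)) ≤
      2 * Real.pi * Real.log (m⁻¹ / m) := by linarith
    exact le_of_mul_le_mul_left h2 (by positivity)
  have hrρ : 0 < r / ρ := by positivity
  rw [← Real.log_mul hrρ.ne' hrρ.ne', Real.log_le_log_iff (by positivity) (by positivity)] at hlog
  have hrc : r * c ≤ 1 := by
    have h1 : r / ρ * (r / ρ) * (m * m) ≤ m⁻¹ / m * (m * m) := by gcongr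
    have h2 : r / ρ * (r / ρ) * (m * m) = (r * c) ^ 2 := by
      rw [hm]; field_simp
    have h3 : m⁻¹ / m * (m * m) = 1 := by field_simp
    rw [h2, h3] at h1
    have h5 : 0 < r * c := by positivity
    nlinarith
  have : 1 < r * c := by
    rw [inv_lt_iff_one_lt_mul₀ hc0] at hr1
    exact hr1
  linarith

theorem hasDerivAt_of_sq_eq {f g : ℂ → ℂ} {g' z : ℂ} (hf : ContinuousAt f z)
    (hsq : ∀ w, f w ^ 2 = g w) (hg : HasDerivAt g g' z) (h0 : f z ≠ 0) :
    HasDerivAt f (g' / (2 * f z)) z := by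
  rw [hasDerivAt_iff_tendsto_slope] at hg ⊢
  have hsum : Tendsto (fun w => f w + f z) (𝓝[≠] z) (𝓝 (2 * f z)) := by
    rw [two_mul]
    exact (hf.tendsto.mono_left nhdsWithin_le_nhds).add_const _
  have h2 : 2 * f z ≠ 0 := mul_ne_zero two_ne_zero h0
  refine (hg.div hsum h2).congr' ?_
  filter_upwards [hsum.eventually_ne h2] with w hw
  simp only [Pi.div_apply, slope_def_field, ← hsq]
  rw [div_div, mul_comm (w - z), ← div_div]
  congr 1
  rw [div_eq_iff hw]
  ring

theorem isSimplyConnected_unitBall : IsSimplyConnected (Metric.ball (0 : ℂ) 1) := by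
  have := Metric.contractibleSpace_ball (x := (0 : ℂ)) one_pos
  exact SimplyConnectedSpace.ofContractible _

/-- The Koebe one-quarter theorem. -/
theorem norm_deriv_le_four_mul_of_injOn {k : ℂ → ℂ}
    (hk : DifferentiableOn ℂ k (Metric.ball 0 1)) (hinj : InjOn k (Metric.ball 0 1)) {c : ℂ}
    (hc : ∀ z ∈ Metric.ball (0 : ℂ) 1, k z ≠ c) : ‖deriv k 0‖ ≤ 4 * ‖k 0 - c‖ := by
  have h0m : (0 : ℂ) ∈ Metric.ball (0 : ℂ) 1 := Metric.mem_ball_self one_pos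
  obtain ⟨h, hcont, hsq⟩ := Complex.exists_continuousOn_pow_eq isSimplyConnected_unitBall
    Metric.isOpen_ball (g := fun z => k z - c) (hk.continuousOn.sub continuousOn_const)
    (by rintro ⟨z, hz, h⟩; exact hc z hz (sub_eq_zero.1 h)) two_ne_zero
  have hne0 : ∀ z ∈ Metric.ball (0 : ℂ) 1, h z ≠ 0 := by
    intro z hz h0
    have := hsq z
    rw [h0] at this
    exact hc z hz (sub_eq_zero.1 (by simpa using this.symm))
  have hkd : ∀ z ∈ Metric.ball (0 : ℂ) 1, HasDerivAt k (deriv k z) z := fun z hz =>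
    (hk.differentiableAt (Metric.isOpen_ball.mem_nhds hz)).hasDerivAt
  have hder : ∀ z ∈ Metric.ball (0 : ℂ) 1, HasDerivAt h (deriv k z / (2 * h z)) z := fun z hz =>
    hasDerivAt_of_sq_eq (hcont.continuousAt (Metric.isOpen_ball.mem_nhds hz)) hsq
      ((hkd z hz).sub_const c) (hne0 z hz)
  have hsumne : ∀ z ∈ Metric.ball (0 : ℂ) 1, ∀ w ∈ Metric.ball (0 : ℂ) 1, h z + h w ≠ 0 := by
    intro z hz w hw hs
    have h1 : h z = -h w := eq_neg_of_add_eq_zero_left hs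
    have h2 : k z = k w := by
      have h3 := hsq z
      rw [h1, neg_sq, hsq w] at h3
      exact (sub_left_injective h3).symm
    have h4 := hinj hz hw h2
    rw [h4] at hs
    exact hne0 w hw (by linear_combination hs / 2)
  -- This Möbius map turns `h ↦ -h` into `G ↦ 1 / G`, so `h z + h w ≠ 0` becomes `G z * G w ≠ 1`.
  -- The factor `4` is `G' 0 = h' 0 / (2 * h 0) = k' 0 / (4 * h 0 ^ 2)`.
  set G : ℂ → ℂ := fun z => (h z - h 0) / (h z + h 0) with hG
  have hGd : ∀ z ∈ Metric.ball (0 : ℂ) 1, HasDerivAt G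
      (((deriv k z / (2 * h z)) * (h z + h 0) - (h z - h 0) * (deriv k z / (2 * h z)))
        / (h z + h 0) ^ 2) z := fun z hz =>
    ((hder z hz).sub_const _).fun_div ((hder z hz).add_const _) (hsumne z hz 0 h0m)
  have hh0 := hne0 0 h0m
  have key := norm_deriv_le_one_of_mul_ne_one (G := G)
    (fun z hz => (hGd z hz).differentiableAt.differentiableWithinAt) ?_ (by simp [hG]) ?_
  · rw [(hGd 0 h0m).deriv] at key
    have h1 : (deriv k 0 / (2 * h 0) * (h 0 + h 0) - (h 0 - h 0) * (deriv k 0 / (2 * h 0))) /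
        (h 0 + h 0) ^ 2 = deriv k 0 / (4 * (k 0 - c)) := by
      have : k 0 - c = h 0 ^ 2 := (hsq 0).symm
      rw [this]
      field_simp
      ring
    have hkc : k 0 - c ≠ 0 := sub_ne_zero.2 (hc 0 h0m)
    have hkc' : 0 < ‖k 0 - c‖ := norm_pos_iff.2 hkc
    rw [h1, norm_div, norm_mul, div_le_one (mul_pos (by norm_num) hkc')] at key
    simpa using key
  · intro z hz w hw hzw
    have h1 := hsumne z hz 0 h0m
    have h2 := hsumne w hw 0 h0m
    simp only [hG] at hzw
    rw [div_eq_div_iff h1 h2] at hzw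
    have h3 : h z = h w := by
      have : 2 * h 0 * (h z - h w) = 0 := by linear_combination hzw
      rcases mul_eq_zero.1 this with h4 | h4
      · exact absurd h4 (mul_ne_zero two_ne_zero hh0)
      · exact sub_eq_zero.1 h4
    refine hinj hz hw ?_
    have h4 := hsq z
    rw [h3, hsq w] at h4
    exact (sub_left_injective h4).symm
  · intro z hz w hw hzw
    have h1 := hsumne z hz 0 h0m
    have h2 := hsumne w hw 0 h0m
    simp only [hG] at hzw
    rw [div_mul_div_comm, div_eq_one_iff_eq (mul_ne_zero h1 h2)] at hzw
    have : 2 * h 0 * (h z + h w) = 0 := by linear_combination -hzw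
    exact (mul_ne_zero (mul_ne_zero two_ne_zero hh0) (hsumne z hz w hw)) this

/-! ### Derivative bounds for maps into half-planes and convex sets -/

theorem norm_deriv_le_of_norm_sub_le {f : ℂ → ℂ} {M : ℝ} (hf : DifferentiableAt ℂ f 0)
    (hb : ∀ z ∈ Metric.ball (0 : ℂ) 1, ‖f z - f 0‖ ≤ M * ‖z‖ / (1 - ‖z‖)) :
    ‖deriv f 0‖ ≤ M := by
  have h1 := (hasDerivAt_iff_tendsto_slope.1 hf.hasDerivAt).norm
  have h2 : Tendsto (fun z : ℂ => M / (1 - ‖z‖)) (𝓝[≠] 0) (𝓝 (M / (1 - ‖(0 : ℂ)‖))) := by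
    refine (ContinuousAt.tendsto ?_).mono_left nhdsWithin_le_nhds
    exact ContinuousAt.div (by fun_prop) (by fun_prop) (by simp)
  rw [norm_zero, sub_zero, div_one] at h2
  refine le_of_tendsto_of_tendsto h1 h2 ?_
  filter_upwards [self_mem_nhdsWithin,
    mem_nhdsWithin_of_mem_nhds (Metric.ball_mem_nhds (0 : ℂ) one_pos)] with z hz hzb
  have hz0 : 0 < ‖z‖ := norm_pos_iff.2 hz
  rw [slope_def_field, norm_div, sub_zero, div_le_iff₀ hz0]
  calc _ ≤ _ := hb z hzb
    _ = _ := by ring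

/-- Borel–Carathéodory applied to `p 0 - p`, whose real part stays below `(p 0).re`. -/
theorem norm_deriv_le_two_mul_of_re_pos {p : ℂ → ℂ}
    (hp : DifferentiableOn ℂ p (Metric.ball 0 1))
    (hpos : ∀ z ∈ Metric.ball (0 : ℂ) 1, 0 < (p z).re) : ‖deriv p 0‖ ≤ 2 * (p 0).re := by
  have h0m : (0 : ℂ) ∈ Metric.ball (0 : ℂ) 1 := Metric.mem_ball_self one_pos
  refine norm_deriv_le_of_norm_sub_le
    (hp.differentiableAt (Metric.ball_mem_nhds _ one_pos)) fun z hz => ?_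
  have := Complex.borelCaratheodory_zero (f := fun z => p 0 - p z) (M := (p 0).re) (R := 1)
    (hpos 0 h0m) (hp.const_sub _) (fun w hw => by
      have := hpos w hw
      simp only [mem_ofPred_eq, Complex.sub_re]
      linarith) one_pos hz (sub_self _)
  rwa [norm_sub_rev]

/-- An omitted point `c` is separated from `D` by a line through `c`, so `k - c`, suitably
multiplied by a constant `u`, has positive real part. Univalence plays no role. -/
theorem norm_deriv_le_two_mul_of_convex {D : Set ℂ} (hD : IsOpen D) (hconv : Convex ℝ D)
    {k : ℂ → ℂ} (hk : DifferentiableOn ℂ k (Metric.ball 0 1))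
    (hmaps : MapsTo k (Metric.ball 0 1) D) {c : ℂ} (hc : c ∉ D) :
    ‖deriv k 0‖ ≤ 2 * ‖k 0 - c‖ := by
  have h0m : (0 : ℂ) ∈ Metric.ball (0 : ℂ) 1 := Metric.mem_ball_self one_pos
  obtain ⟨l, hl⟩ := geometric_hahn_banach_open_point hconv hD hc
  set u : ℂ := ⟨-l 1, l Complex.I⟩ with hu
  have hlu : ∀ z, (u * (z - c)).re = l c - l z := by
    intro z
    have h1 : z - c = (z - c).re • (1 : ℂ) + (z - c).im • Complex.I := by
      apply Complex.ext <;> simp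
    have h2 : l (z - c) = (z - c).re * l 1 + (z - c).im * l Complex.I := by
      conv_lhs => rw [h1]
      rw [map_add, map_smul, map_smul, smul_eq_mul, smul_eq_mul]
    rw [map_sub] at h2
    rw [Complex.mul_re]
    simp only [hu]
    linarith
  have key := norm_deriv_le_two_mul_of_re_pos (p := fun z => u * (k z - c))
    ((hk.sub_const c).const_mul u) (fun z hz => by
      rw [hlu]
      exact sub_pos.2 (hl _ (hmaps hz)))
  have hkd := hk.differentiableAt (Metric.ball_mem_nhds (0 : ℂ) one_pos)
  have hd : deriv (fun z => u * (k z - c)) 0 = u * deriv k 0 :=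
    ((hkd.hasDerivAt.sub_const c).const_mul u).deriv
  rw [hd, norm_mul] at key
  have hpos : 0 < (u * (k 0 - c)).re := by
    rw [hlu]; exact sub_pos.2 (hl _ (hmaps h0m))
  have hu0 : 0 < ‖u‖ := by
    rw [norm_pos_iff]
    intro h
    rw [h, zero_mul] at hpos
    exact lt_irrefl _ hpos
  have h3 : (u * (k 0 - c)).re ≤ ‖u‖ * ‖k 0 - c‖ := by
    rw [← norm_mul]; exact Complex.re_le_norm _
  refine le_of_mul_le_mul_left ?_ hu0
  linarith

/-! ### Möbius automorphisms of the disk -/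

open ComplexConjugate

/-- The Möbius map of the unit disk that sends `a` to `0`. -/
noncomputable def diskMobius (a z : ℂ) : ℂ := (z - a) / (1 - conj a * z)

theorem diskMobius_self (a : ℂ) : diskMobius a a = 0 := by simp [diskMobius]

theorem one_sub_conj_mul_ne_zero {a z : ℂ} (ha : ‖a‖ < 1) (hz : ‖z‖ < 1) :
    1 - conj a * z ≠ 0 := by
  intro h
  have h1 : ‖conj a * z‖ = 1 := by rw [← sub_eq_zero.1 h, norm_one]
  rw [norm_mul, Complex.norm_conj] at h1
  nlinarith [norm_nonneg a, norm_nonneg z]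

theorem norm_one_sub_conj_mul_sq_sub (a z : ℂ) :
    ‖1 - conj a * z‖ ^ 2 - ‖z - a‖ ^ 2 = (1 - ‖a‖ ^ 2) * (1 - ‖z‖ ^ 2) := by
  simp only [← Complex.normSq_eq_norm_sq, Complex.normSq_apply, Complex.sub_re, Complex.sub_im,
    Complex.mul_re, Complex.mul_im, Complex.conj_re, Complex.conj_im, Complex.one_re,
    Complex.one_im]
  ring

theorem norm_diskMobius_lt_one {a z : ℂ} (ha : ‖a‖ < 1) (hz : ‖z‖ < 1) :
    ‖diskMobius a z‖ < 1 := by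
  have h := one_sub_conj_mul_ne_zero ha hz
  rw [diskMobius, norm_div, div_lt_one (norm_pos_iff.2 h)]
  refine lt_of_pow_lt_pow_left₀ 2 (norm_nonneg _) ?_
  have h1 := norm_one_sub_conj_mul_sq_sub a z
  have h2 : 0 < (1 - ‖a‖ ^ 2) * (1 - ‖z‖ ^ 2) := by
    apply mul_pos <;> nlinarith [norm_nonneg a, norm_nonneg z]
  linarith

theorem hasDerivAt_diskMobius {a z : ℂ} (ha : ‖a‖ < 1) (hz : ‖z‖ < 1) :
    HasDerivAt (diskMobius a) ((1 - ‖a‖ ^ 2 : ℝ) / (1 - conj a * z) ^ 2) z := by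
  have h := one_sub_conj_mul_ne_zero ha hz
  have h1 := ((hasDerivAt_id z).sub_const a).fun_div
    (((hasDerivAt_id z).const_mul (conj a)).const_sub 1) h
  refine h1.congr_deriv ?_
  congr 1
  have : conj a * a = ((‖a‖ ^ 2 : ℝ) : ℂ) := by
    rw [← Complex.normSq_eq_norm_sq, Complex.normSq_eq_conj_mul_self]
  push_cast at this ⊢
  simp only [id]
  linear_combination -this

theorem diskMobius_injOn {a z w : ℂ} (ha : ‖a‖ < 1) (hz : ‖z‖ < 1) (hw : ‖w‖ < 1)
    (h : diskMobius a z = diskMobius a w) : z = w := by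
  rw [diskMobius, diskMobius,
    div_eq_div_iff (one_sub_conj_mul_ne_zero ha hz) (one_sub_conj_mul_ne_zero ha hw)] at h
  have h1 : (1 - conj a * a) * (z - w) = 0 := by linear_combination h
  rcases mul_eq_zero.1 h1 with h2 | h2
  · exact absurd h2 (one_sub_conj_mul_ne_zero ha ha)
  · exact sub_eq_zero.1 h2

theorem one_sub_conj_mul_self_norm {a : ℂ} (ha : ‖a‖ < 1) :
    ‖1 - conj a * a‖ = 1 - ‖a‖ ^ 2 := by
  have : 1 - conj a * a = ((1 - ‖a‖ ^ 2 : ℝ) : ℂ) := by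
    rw [← Complex.normSq_eq_norm_sq, ← Complex.normSq_eq_conj_mul_self]
    push_cast; rfl
  rw [this, Complex.norm_real, Real.norm_of_nonneg]
  nlinarith [norm_nonneg a]

/-! ### Disk embeddings and approximate Riemann mapping -/

/-- Holomorphic embeddings of `D` into the unit disk. -/
structure IsDiskEmbedding (D : Set ℂ) (f : ℂ → ℂ) : Prop where
  mapsTo : MapsTo f D (Metric.ball 0 1)
  injOn : InjOn f D
  deriv_ne_zero : ∀ z ∈ D, deriv f z ≠ 0

namespace IsDiskEmbedding

variable {D : Set ℂ} {f : ℂ → ℂ}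

/-- `deriv` is `0` where a function is not differentiable, so the nonvanishing derivative already
encodes holomorphy. -/
theorem hasDerivAt (hf : IsDiskEmbedding D f) {z : ℂ} (hz : z ∈ D) :
    HasDerivAt f (deriv f z) z :=
  (differentiableAt_of_deriv_ne_zero (hf.deriv_ne_zero z hz)).hasDerivAt

theorem differentiableOn (hf : IsDiskEmbedding D f) : DifferentiableOn ℂ f D :=
  fun _ hz => (hf.hasDerivAt hz).differentiableAt.differentiableWithinAt

theorem norm_lt_one (hf : IsDiskEmbedding D f) {z : ℂ} (hz : z ∈ D) : ‖f z‖ < 1 :=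
  mem_ball_zero_iff.1 (hf.mapsTo hz)

theorem hasDerivAt_diskMobius_comp (hf : IsDiskEmbedding D f) {a z : ℂ} (ha : ‖a‖ < 1)
    (hz : z ∈ D) : HasDerivAt (fun z => diskMobius a (f z))
      ((1 - ‖a‖ ^ 2 : ℝ) / (1 - conj a * f z) ^ 2 * deriv f z) z :=
  (hasDerivAt_diskMobius ha (hf.norm_lt_one hz)).comp z (hf.hasDerivAt hz)

theorem diskMobius_comp (hf : IsDiskEmbedding D f) {a : ℂ} (ha : ‖a‖ < 1) :
    IsDiskEmbedding D (fun z => diskMobius a (f z)) where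
  mapsTo z hz := mem_ball_zero_iff.2 (norm_diskMobius_lt_one ha (hf.norm_lt_one hz))
  injOn z hz w hw h :=
    hf.injOn hz hw (diskMobius_injOn ha (hf.norm_lt_one hz) (hf.norm_lt_one hw) h)
  deriv_ne_zero z hz := by
    rw [(hf.hasDerivAt_diskMobius_comp ha hz).deriv]
    have h1 : (1 - ‖a‖ ^ 2 : ℝ) ≠ 0 := by nlinarith [norm_nonneg a]
    exact mul_ne_zero (div_ne_zero (by exact_mod_cast h1)
      (pow_ne_zero 2 (one_sub_conj_mul_ne_zero ha (hf.norm_lt_one hz)))) (hf.deriv_ne_zero z hz)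

theorem const_mul (hf : IsDiskEmbedding D f) {u : ℂ} (hu : ‖u‖ = 1) :
    IsDiskEmbedding D (fun z => u * f z) := by
  have hu0 : u ≠ 0 := by intro h; rw [h, norm_zero] at hu; exact zero_ne_one hu
  refine ⟨fun z hz => ?_, fun z hz w hw h => hf.injOn hz hw (mul_left_cancel₀ hu0 h),
    fun z hz => ?_⟩
  · rw [mem_ball_zero_iff, norm_mul, hu, one_mul]
    exact hf.norm_lt_one hz
  · rw [((hf.hasDerivAt hz).const_mul u).deriv]
    exact mul_ne_zero hu0 (hf.deriv_ne_zero z hz)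

/-- Koebe's osculation: an omitted value of the disk gives an embedding with larger derivative. -/
theorem exists_norm_deriv_eq (hf : IsDiskEmbedding D f) (hD : IsOpen D)
    (hDs : IsSimplyConnected D) (h0 : (0 : ℂ) ∈ D) (hf0 : f 0 = 0) {w : ℂ} (hw : ‖w‖ < 1)
    (hwf : w ∉ f '' D) :
    ∃ g, IsDiskEmbedding D g ∧ g 0 = 0 ∧
      ‖deriv g 0‖ = ‖deriv f 0‖ * ((1 + ‖w‖) / (2 * √‖w‖)) := by
  have hw0 : w ≠ 0 := fun h => hwf ⟨0, h0, by rw [hf0, h]⟩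
  -- Moving the omitted value `w` to `0` permits a square root `s`, which is then renormalized at
  -- `0`. The three steps multiply the derivative by `1 - ‖w‖ ^ 2`, `1 / (2 * √‖w‖)` and `1 / (1 -
  -- ‖w‖)` in modulus.
  set m : ℂ → ℂ := fun z => diskMobius w (f z) with hm
  have hme : IsDiskEmbedding D m := hf.diskMobius_comp hw
  have hm0 : ∀ z ∈ D, m z ≠ 0 := by
    intro z hz h
    rw [hm, ← diskMobius_self w] at h
    exact hwf ⟨z, hz, diskMobius_injOn hw (hf.norm_lt_one hz) hw h⟩
  obtain ⟨s, hcont, hsq⟩ := Complex.exists_continuousOn_pow_eq hDs hD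
    hme.differentiableOn.continuousOn (by rintro ⟨z, hz, h⟩; exact hm0 z hz h) two_ne_zero
  have hs0 : ∀ z ∈ D, s z ≠ 0 := by
    intro z hz h
    refine hm0 z hz ?_
    rw [← hsq, h]
    norm_num
  have hsd : ∀ z ∈ D, HasDerivAt s (deriv m z / (2 * s z)) z := fun z hz =>
    hasDerivAt_of_sq_eq (hcont.continuousAt (hD.mem_nhds hz)) hsq (hme.hasDerivAt hz) (hs0 z hz)
  have hse : IsDiskEmbedding D s := by
    refine ⟨fun z hz => ?_, fun z hz w hw h => hme.injOn hz hw ?_, fun z hz => ?_⟩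
    · rw [mem_ball_zero_iff]
      have h1 := hme.norm_lt_one hz
      rw [← hsq, norm_pow] at h1
      by_contra! h2
      exact h1.not_ge (one_le_pow₀ h2)
    · rw [← hsq, ← hsq, h]
    · rw [(hsd z hz).deriv]
      exact div_ne_zero (hme.deriv_ne_zero z hz) (mul_ne_zero two_ne_zero (hs0 z hz))
  have hs1 : ‖s 0‖ < 1 := hse.norm_lt_one h0
  refine ⟨_, hse.diskMobius_comp hs1, diskMobius_self _, ?_⟩
  have hsn : ‖s 0‖ ^ 2 = ‖w‖ := by
    rw [← norm_pow, hsq]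
    simp [hm, hf0, diskMobius]
  have hsn' : ‖s 0‖ = √‖w‖ := by rw [← hsn, Real.sqrt_sq (norm_nonneg _)]
  rw [(hse.hasDerivAt_diskMobius_comp hs1 h0).deriv, (hsd 0 h0).deriv,
    (hf.hasDerivAt_diskMobius_comp hw h0).deriv, hf0, mul_zero, sub_zero]
  have hwpos : 0 < ‖w‖ := norm_pos_iff.2 hw0
  have hsqpos : 0 < √‖w‖ := Real.sqrt_pos.2 hwpos
  rw [norm_mul, norm_div, norm_div, norm_mul, norm_mul, norm_pow, one_sub_conj_mul_self_norm hs1,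
    hsn, hsn', Complex.norm_real, Real.norm_of_nonneg (show 0 ≤ 1 - ‖w‖ by linarith), one_pow, div_one,
    Complex.norm_real, Real.norm_of_nonneg (show 0 ≤ 1 - ‖w‖ ^ 2 by nlinarith), Complex.norm_ofNat]
  have : 1 - ‖w‖ ≠ 0 := by linarith
  field_simp
  ring

end IsDiskEmbedding

/-- A branch `s` of `√(z - c)` never takes both a value and its negative. Since `s '' D` contains a
disk about `s 0`, it misses one about `-s 0`, and inversion there makes the image bounded. -/
theorem exists_isDiskEmbedding {D : Set ℂ} (hD : IsOpen D) (hDs : IsSimplyConnected D)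
    (hne : D ≠ univ) (h0 : (0 : ℂ) ∈ D) : ∃ f, IsDiskEmbedding D f ∧ f 0 = 0 := by
  obtain ⟨c, hc⟩ := (ne_univ_iff_exists_notMem D).1 hne
  obtain ⟨s, hcont, hsq⟩ := Complex.exists_continuousOn_pow_eq hDs hD
    (g := fun z => z - c) (by fun_prop)
    (by rintro ⟨z, hz, h⟩; exact hc (sub_eq_zero.1 h ▸ hz)) two_ne_zero
  have hs0 : ∀ z ∈ D, s z ≠ 0 := by
    intro z hz h
    have h1 := hsq z
    rw [h, zero_pow two_ne_zero, eq_comm, sub_eq_zero] at h1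
    exact hc (h1 ▸ hz)
  have hsd : ∀ z ∈ D, HasDerivAt s (1 / (2 * s z)) z := fun z hz =>
    hasDerivAt_of_sq_eq (hcont.continuousAt (hD.mem_nhds hz)) hsq
      ((hasDerivAt_id z).sub_const c) (hs0 z hz)
  have hinj : ∀ z w, s z ^ 2 = s w ^ 2 → z = w := by
    intro z w h
    rw [hsq, hsq] at h
    exact sub_left_injective h
  have hdiff : DifferentiableOn ℂ s D := fun z hz =>
    (hsd z hz).differentiableAt.differentiableWithinAt
  have hnhds : s '' D ∈ 𝓝 (s 0) := by
    have hst : HasStrictDerivAt s (1 / (2 * s 0)) 0 := by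
      have := (hdiff.analyticAt (hD.mem_nhds h0)).hasStrictDerivAt
      rwa [(hsd 0 h0).deriv] at this
    rw [← hst.map_nhds_eq (one_div_ne_zero (mul_ne_zero two_ne_zero (hs0 0 h0)))]
    exact image_mem_map (hD.mem_nhds h0)
  obtain ⟨ε, hε, hball⟩ := Metric.mem_nhds_iff.1 hnhds
  have hfar : ∀ z ∈ D, ε ≤ ‖s z + s 0‖ := by
    intro z hz
    by_contra! hlt
    obtain ⟨w, hw, hwz⟩ := hball (show -s z ∈ Metric.ball (s 0) ε by
      rwa [mem_ball_iff_norm, ← norm_neg, neg_sub, sub_neg_eq_add, add_comm])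
    have h1 := hinj w z (by rw [hwz, neg_sq])
    rw [h1] at hwz
    exact hs0 z hz (by linear_combination hwz / 2)
  have hne0 : ∀ z ∈ D, s z + s 0 ≠ 0 := fun z hz => norm_pos_iff.1 (hε.trans_le (hfar z hz))
  have hε2 : (((ε / 2 : ℝ)) : ℂ) ≠ 0 := by exact_mod_cast (half_pos hε).ne'
  have hf : IsDiskEmbedding D (fun z => ((ε / 2 : ℝ) : ℂ) / (s z + s 0)) := by
    refine ⟨fun z hz => ?_, fun z hz w hw h => ?_, fun z hz => ?_⟩
    · rw [mem_ball_zero_iff, norm_div, Complex.norm_real, Real.norm_of_nonneg (half_pos hε).le,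
        div_lt_one (hε.trans_le (hfar z hz))]
      linarith [hfar z hz]
    · have h1 := mul_left_cancel₀ hε2 ((div_eq_div_iff (hne0 z hz) (hne0 w hw)).1 h)
      exact hinj z w (by rw [add_right_cancel h1])
    · rw [((hasDerivAt_const z _).fun_div ((hsd z hz).add_const (s 0)) (hne0 z hz)).deriv]
      have := hs0 z hz
      have := hne0 z hz
      rw [zero_mul, zero_sub]
      exact div_ne_zero (neg_ne_zero.2 (mul_ne_zero hε2
        (one_div_ne_zero (mul_ne_zero two_ne_zero (hs0 z hz))))) (pow_ne_zero 2 this)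
  exact ⟨_, hf.diskMobius_comp (hf.norm_lt_one h0), diskMobius_self _⟩

/-- An approximate Riemann mapping theorem: the image contains a disk of radius close to one. -/
theorem exists_isDiskEmbedding_ball_subset {D : Set ℂ} (hD : IsOpen D)
    (hDs : IsSimplyConnected D) (hne : D ≠ univ) (h0 : (0 : ℂ) ∈ D) {r : ℝ} (hr0 : 0 < r)
    (hr1 : r < 1) :
    ∃ f, IsDiskEmbedding D f ∧ f 0 = 0 ∧ Metric.ball 0 r ⊆ f '' D ∧
      deriv f 0 = (‖deriv f 0‖ : ℂ) := by
  set S : Set ℝ := {v | ∃ f, IsDiskEmbedding D f ∧ f 0 = 0 ∧ v = ‖deriv f 0‖} with hS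
  have hSne : S.Nonempty := by
    obtain ⟨f, hf, hf0⟩ := exists_isDiskEmbedding hD hDs hne h0
    exact ⟨_, f, hf, hf0, rfl⟩
  obtain ⟨R, hR, hRD⟩ := Metric.isOpen_iff.1 hD 0 h0
  have hSb : BddAbove S := by
    refine ⟨1 / R, ?_⟩
    rintro _ ⟨f, hf, hf0, rfl⟩
    refine Complex.norm_deriv_le_div_of_mapsTo_ball (hf.differentiableOn.mono hRD) ?_ hR
    intro z hz
    rw [hf0]
    exact Metric.ball_subset_closedBall (hf.mapsTo (hRD hz))
  have hSpos : 0 < sSup S := by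
    obtain ⟨f, hf, hf0⟩ := exists_isDiskEmbedding hD hDs hne h0
    exact (norm_pos_iff.2 (hf.deriv_ne_zero 0 h0)).trans_le (le_csSup hSb ⟨f, hf, hf0, rfl⟩)
  have hσ : 0 < √r := Real.sqrt_pos.2 hr0
  have hσ2 : √r ^ 2 = r := Real.sq_sqrt hr0.le
  have hσ1 : √r < 1 := by
    rw [Real.sqrt_lt' one_pos]
    linarith
  -- `κ⁻¹` is the osculation gain `(1 + t ^ 2) / (2 * t)` at `t = √r`. The gain decreases in `t`, so
  -- an `f` within the factor `κ` of the supremum cannot omit a `w` with `‖w‖ < r`; no extremal map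
  -- is needed.
  set κ := (2 * √r) / (1 + r) with hκ
  have hκ1 : κ < 1 := by
    rw [hκ, div_lt_one (by positivity)]
    nlinarith [sq_pos_of_pos (sub_pos.2 hσ1)]
  have hκ0 : 0 < κ := by positivity
  obtain ⟨_, ⟨f, hf, hf0, rfl⟩, hfS⟩ := exists_lt_of_lt_csSup hSne
    (show sSup S * κ < sSup S by nlinarith)
  have hsub : Metric.ball 0 r ⊆ f '' D := by
    intro w hw
    rw [mem_ball_zero_iff] at hw
    by_contra hwf
    obtain ⟨g, hg, hg0, hgd⟩ := hf.exists_norm_deriv_eq hD hDs h0 hf0 (hw.trans hr1) hwf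
    have hle : ‖deriv g 0‖ ≤ sSup S := le_csSup hSb ⟨g, hg, hg0, rfl⟩
    have hw0 : 0 < ‖w‖ := norm_pos_iff.2 fun h => hwf ⟨0, h0, by rw [hf0, h]⟩
    have hs0 : 0 < √‖w‖ := Real.sqrt_pos.2 hw0
    have hs2 : √‖w‖ ^ 2 = ‖w‖ := Real.sq_sqrt hw0.le
    have hsσ : √‖w‖ < √r := Real.sqrt_lt_sqrt hw0.le hw
    have hfac : κ⁻¹ ≤ (1 + ‖w‖) / (2 * √‖w‖) := by
      rw [hκ, inv_div, div_le_div_iff₀ (by positivity) (by positivity), ← hs2, ← hσ2,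
        Real.sqrt_sq hs0.le, Real.sqrt_sq hσ.le]
      nlinarith [mul_pos (sub_pos.2 hsσ) (show 0 < 1 - √‖w‖ * √r by nlinarith)]
    have h1 : sSup S < ‖deriv f 0‖ * κ⁻¹ := by
      rwa [← div_eq_mul_inv, lt_div_iff₀ hκ0]
    have h2 : ‖deriv f 0‖ * κ⁻¹ ≤ ‖deriv f 0‖ * ((1 + ‖w‖) / (2 * √‖w‖)) := by gcongr
    linarith
  have ha : deriv f 0 ≠ 0 := hf.deriv_ne_zero 0 h0
  have hna : (‖deriv f 0‖ : ℂ) ≠ 0 := by exact_mod_cast (norm_pos_iff.2 ha).ne'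
  set u : ℂ := ‖deriv f 0‖ / deriv f 0 with hu
  have hu1 : ‖u‖ = 1 := by
    rw [hu, norm_div, Complex.norm_real, norm_norm, div_self (norm_pos_iff.2 ha).ne']
  have hu0 : u ≠ 0 := div_ne_zero hna ha
  refine ⟨_, hf.const_mul hu1, by rw [hf0, mul_zero], fun w hw => ?_, ?_⟩
  · have : u⁻¹ * w ∈ Metric.ball (0 : ℂ) r := by
      rw [mem_ball_zero_iff] at hw ⊢
      rwa [norm_mul, norm_inv, hu1, inv_one, one_mul]
    obtain ⟨z, hz, hzw⟩ := hsub this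
    exact ⟨z, hz, by simp only [hzw, mul_inv_cancel_left₀ hu0]⟩
  · rw [((hf.hasDerivAt h0).const_mul u).deriv, norm_mul, hu1, one_mul, hu,
      div_mul_cancel₀ _ ha]

/-! ### Uniform Schwarz–Pick bounds and rigidity -/

/-- A holomorphic map to the unit disk stays away from the unit circle near a point. -/
theorem norm_sq_le_of_mapsTo_ball {f : ℂ → ℂ} {p z : ℂ} {R ρ : ℝ}
    (hf : DifferentiableOn ℂ f (Metric.ball p R))
    (hmaps : MapsTo f (Metric.ball p R) (Metric.ball 0 1)) (hρ : ρ < 1) (hp : ‖f p‖ ≤ ρ)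
    (hz : ‖z - p‖ < R / 2) : ‖f z‖ ^ 2 ≤ 1 - 3 / 4 * (1 - ρ) ^ 2 := by
  have hR : 0 < R := by linarith [norm_nonneg (z - p)]
  have hzb : z ∈ Metric.ball p R := by rw [mem_ball_iff_norm]; linarith
  have hlt : ∀ w ∈ Metric.ball p R, ‖f w‖ < 1 := fun w hw => mem_ball_zero_iff.1 (hmaps hw)
  have hp1 : ‖f p‖ < 1 := hp.trans_lt hρ
  have hd : DifferentiableOn ℂ (fun w => diskMobius (f p) (f w)) (Metric.ball p R) :=
    fun w hw => ((hasDerivAt_diskMobius hp1 (hlt w hw)).differentiableAt.comp w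
      (hf.differentiableAt (Metric.isOpen_ball.mem_nhds hw))).differentiableWithinAt
  have h1 := Complex.dist_le_div_mul_dist_of_mapsTo_ball hd (R₂ := 1) (fun w hw => by
    rw [diskMobius_self, mem_closedBall_zero_iff]
    exact (norm_diskMobius_lt_one hp1 (hlt w hw)).le) hzb
  simp only [diskMobius_self, dist_zero_right] at h1
  rw [dist_eq_norm] at h1
  -- On the half-size ball the pseudo-hyperbolic distance from `f p` is at most `1 / 2`; the
  -- constant `3 / 4` is `1 - (1 / 2) ^ 2`.
  have h2 : ‖diskMobius (f p) (f z)‖ ≤ 1 / 2 := by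
    refine h1.trans ?_
    rw [one_div_mul_eq_div, div_le_iff₀ hR]
    linarith
  have hne := one_sub_conj_mul_ne_zero hp1 (hlt z hzb)
  have hid := norm_one_sub_conj_mul_sq_sub (f p) (f z)
  rw [diskMobius, norm_div, div_le_iff₀ (norm_pos_iff.2 hne)] at h2
  have h3 : 1 - ρ ≤ ‖1 - conj (f p) * f z‖ := by
    have h4 := norm_sub_norm_le (1 : ℂ) (conj (f p) * f z)
    rw [norm_one, norm_mul, Complex.norm_conj] at h4
    have h5 : ‖f p‖ * ‖f z‖ ≤ ‖f p‖ * 1 :=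
      mul_le_mul_of_nonneg_left (hlt z hzb).le (norm_nonneg _)
    linarith
  have h6 : ‖f z - f p‖ ^ 2 ≤ (1 / 2 * ‖1 - conj (f p) * f z‖) ^ 2 :=
    pow_le_pow_left₀ (norm_nonneg _) h2 2
  have h7 : (1 - ρ) ^ 2 ≤ ‖1 - conj (f p) * f z‖ ^ 2 := pow_le_pow_left₀ (by linarith) h3 2
  have h8 : (1 - ‖f p‖ ^ 2) * (1 - ‖f z‖ ^ 2) ≤ 1 * (1 - ‖f z‖ ^ 2) := by
    refine mul_le_mul_of_nonneg_right (by nlinarith [sq_nonneg ‖f p‖]) ?_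
    nlinarith [hlt z hzb, norm_nonneg (f z)]
  nlinarith

theorem exists_forall_norm_le_near {D : Set ℂ} {p : ℂ} {R : ℝ} (hR : Metric.ball p R ⊆ D)
    {ρ : ℝ} (hρ : ρ < 1)
    (hp : ∀ f : ℂ → ℂ, DifferentiableOn ℂ f D → MapsTo f D (Metric.ball 0 1) → f 0 = 0 →
      ‖f p‖ ≤ ρ) :
    ∃ ρ' < 1, ∀ f : ℂ → ℂ, DifferentiableOn ℂ f D → MapsTo f D (Metric.ball 0 1) → f 0 = 0 →
      ∀ z, ‖z - p‖ < R / 2 → ‖f z‖ ≤ ρ' := by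
  refine ⟨√(1 - 3 / 4 * (1 - ρ) ^ 2), ?_, fun f hf hm h0 z hz => Real.le_sqrt_of_sq_le
    (norm_sq_le_of_mapsTo_ball (hf.mono hR) (hm.mono_left hR) hρ (hp f hf hm h0) hz)⟩
  rw [Real.sqrt_lt' one_pos]
  nlinarith [sq_pos_of_pos (sub_pos.2 hρ)]

/-- Holomorphic self-maps into the disk fixing `0` are uniformly bounded away from the circle on
compact sets. -/
theorem exists_forall_norm_le_on_compact {D K : Set ℂ} (hD : IsOpen D) (hDc : IsPreconnected D)
    (h0 : (0 : ℂ) ∈ D) (hK : IsCompact K) (hKD : K ⊆ D) :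
    ∃ ρ < 1, ∀ f : ℂ → ℂ, DifferentiableOn ℂ f D → MapsTo f D (Metric.ball 0 1) → f 0 = 0 →
      ∀ z ∈ K, ‖f z‖ ≤ ρ := by
  set U : Set ℂ := {p | p ∈ D ∧ ∃ ρ < 1, ∀ f : ℂ → ℂ, DifferentiableOn ℂ f D →
    MapsTo f D (Metric.ball 0 1) → f 0 = 0 → ‖f p‖ ≤ ρ} with hU
  have hstep : ∀ p ∈ U, ∀ R, Metric.ball p R ⊆ D → Metric.ball p (R / 2) ⊆ U := by
    rintro p ⟨hp, ρ, hρ, hb⟩ R hR z hz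
    obtain ⟨ρ', hρ', hb'⟩ := exists_forall_norm_le_near hR hρ hb
    have hR0 : 0 < R / 2 := Metric.nonempty_ball.1 ⟨z, hz⟩
    exact ⟨hR (Metric.ball_subset_ball (by linarith) hz), ρ', hρ', fun f h1 h2 h3 =>
      hb' f h1 h2 h3 z (mem_ball_iff_norm.1 hz)⟩
  have hUo : IsOpen U := by
    rw [Metric.isOpen_iff]
    intro p hp
    obtain ⟨R, hR, hRD⟩ := Metric.isOpen_iff.1 hD p hp.1
    exact ⟨R / 2, half_pos hR, hstep p hp R hRD⟩
  have hDU : D ⊆ U := by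
    refine hDc.subset_of_closure_inter_subset hUo ⟨0, h0, h0, 0, one_pos, ?_⟩ ?_
    · intro f _ _ hf0
      rw [hf0, norm_zero]
    · rintro z ⟨hzc, hzD⟩
      obtain ⟨R, hR, hRD⟩ := Metric.isOpen_iff.1 hD z hzD
      obtain ⟨p, hp, hpz⟩ := Metric.mem_closure_iff.1 hzc (R / 3) (by positivity)
      -- Since `‖p - z‖ < R / 3`, the ball of radius `2R / 3` about `p` lies in `D` and its half
      -- contains `z`; thus `U` is relatively closed in `D`.
      refine hstep p hp (2 * R / 3) (fun w hw => hRD ?_) ?_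
      · rw [Metric.mem_ball] at hw ⊢
        have := dist_triangle w p z
        rw [dist_comm p z] at this
        linarith
      · rw [Metric.mem_ball]
        linarith
  refine hK.induction_on (p := fun K => ∃ ρ < 1, ∀ f : ℂ → ℂ, DifferentiableOn ℂ f D →
    MapsTo f D (Metric.ball 0 1) → f 0 = 0 → ∀ z ∈ K, ‖f z‖ ≤ ρ) ⟨0, one_pos, by simp⟩ ?_ ?_ ?_
  · rintro s t hst ⟨ρ, hρ, h⟩
    exact ⟨ρ, hρ, fun f h1 h2 h3 z hz => h f h1 h2 h3 z (hst hz)⟩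
  · rintro s t ⟨ρ, hρ, h⟩ ⟨ρ', hρ', h'⟩
    refine ⟨max ρ ρ', max_lt hρ hρ', fun f h1 h2 h3 z hz => ?_⟩
    rcases hz with hz | hz
    · exact (h f h1 h2 h3 z hz).trans (le_max_left _ _)
    · exact (h' f h1 h2 h3 z hz).trans (le_max_right _ _)
  · intro p hp
    obtain ⟨_, ρ, hρ, hb⟩ := hDU (hKD hp)
    obtain ⟨R, hR, hRD⟩ := Metric.isOpen_iff.1 hD p (hKD hp)
    obtain ⟨ρ', hρ', hb'⟩ := exists_forall_norm_le_near hRD hρ hb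
    exact ⟨Metric.ball p (R / 2), mem_nhdsWithin_of_mem_nhds
      (Metric.ball_mem_nhds _ (half_pos hR)), ρ', hρ', fun f h1 h2 h3 z hz =>
      hb' f h1 h2 h3 z (mem_ball_iff_norm.1 hz)⟩

/-- A quantitative form of the rigidity in the Schwarz lemma. -/
theorem norm_sub_self_le_of_deriv_eq_one {h : ℂ → ℂ} {r ρ : ℝ} (hr0 : 0 < r) (hr1 : r < 1)
    (hρr : ρ < r) (hd : DifferentiableOn ℂ h (Metric.ball 0 r))
    (hmaps : MapsTo h (Metric.ball 0 r) (Metric.ball 0 1)) (h0 : h 0 = 0) (h1 : deriv h 0 = 1)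
    {w : ℂ} (hw : ‖w‖ ≤ ρ) : ‖h w - w‖ ≤ 2 * (1 / r - 1) / (r - ρ) := by
  have hwb : w ∈ Metric.ball (0 : ℂ) r := by rw [mem_ball_zero_iff]; linarith
  have hM : 0 < 1 / r - 1 := by
    rw [sub_pos, lt_div_iff₀ hr0]; linarith
  -- The quotient `h z / z` has value `1` at `0` and modulus at most `1 / r`, so the real part of
  -- its excess over `1` is at most `1 / r - 1`; Borel–Carathéodory bounds the whole excess.
  have hk : ∀ z ∈ Metric.ball (0 : ℂ) r, ‖dslope h 0 z‖ ≤ 1 / r := fun z hz =>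
    Complex.norm_dslope_le_div_of_mapsTo_ball hd (by
      rw [h0]; exact hmaps.mono_right Metric.ball_subset_closedBall) hz
  have hkd : DifferentiableOn ℂ (dslope h 0) (Metric.ball 0 r) :=
    (Complex.differentiableOn_dslope (Metric.ball_mem_nhds _ hr0)).2 hd
  have hBC := Complex.borelCaratheodory_zero (f := fun z => dslope h 0 z - 1) hM
    (hkd.sub_const 1) (fun z hz => by
      simp only [mem_ofPred_eq, Complex.sub_re, Complex.one_re]
      linarith [Complex.re_le_norm (dslope h 0 z), hk z hz]) hr0 hwb
    (by rw [dslope_same, h1, sub_self])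
  have hw' : h w - w = w * (dslope h 0 w - 1) := by
    have := sub_smul_dslope h 0 w
    rw [h0, sub_zero, sub_zero, smul_eq_mul] at this
    rw [mul_sub, this, mul_one]
  rw [hw', norm_mul]
  have hwn := norm_nonneg w
  calc ‖w‖ * ‖dslope h 0 w - 1‖ ≤ 1 * ‖dslope h 0 w - 1‖ := by
        gcongr; linarith
    _ = ‖dslope h 0 w - 1‖ := one_mul _
    _ ≤ _ := hBC
    _ ≤ 2 * (1 / r - 1) * 1 / (r - ρ) := by
        have : 0 < r - ρ := sub_pos.2 hρr
        gcongr
        linarith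
    _ = _ := by rw [mul_one]

/-! ### Koebe distortion and near-symmetry of embeddings -/

/-- The constant `κ` satisfies `|k'(0)| ≤ κ dist(k 0, Dᶜ)` for univalent maps `k` of the unit disk
into `D`. -/
def HasKoebeConstant (D : Set ℂ) (κ : ℝ) : Prop :=
  ∀ k : ℂ → ℂ, DifferentiableOn ℂ k (Metric.ball 0 1) → InjOn k (Metric.ball 0 1) →
    MapsTo k (Metric.ball 0 1) D → ∀ c ∉ D, ‖deriv k 0‖ ≤ κ * ‖k 0 - c‖

theorem hasKoebeConstant_four (D : Set ℂ) : HasKoebeConstant D 4 :=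
  fun _ hk hinj hmaps _ hc => norm_deriv_le_four_mul_of_injOn hk hinj
    fun _ hz h => hc (h ▸ hmaps hz)

theorem hasKoebeConstant_two {D : Set ℂ} (hD : IsOpen D) (hconv : Convex ℝ D) :
    HasKoebeConstant D 2 :=
  fun _ hk _ hmaps _ hc => norm_deriv_le_two_mul_of_convex hD hconv hk hmaps hc

namespace IsDiskEmbedding

variable {D : Set ℂ} {f : ℂ → ℂ}

/-- By injectivity the set-theoretic inverse agrees with the local holomorphic inverse near each
point, and so inherits its derivative. -/
theorem exists_inverse (hf : IsDiskEmbedding D f) (hD : IsOpen D) {r : ℝ}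
    (hr : Metric.ball 0 r ⊆ f '' D) :
    ∃ ψ : ℂ → ℂ, (∀ w ∈ Metric.ball (0 : ℂ) r, ψ w ∈ D ∧ f (ψ w) = w ∧
      HasDerivAt ψ (deriv f (ψ w))⁻¹ w) ∧ ∀ z ∈ D, ‖f z‖ < r → ψ (f z) = z := by
  set ψ := Function.invFunOn f D with hψ
  have hmem : ∀ w ∈ Metric.ball (0 : ℂ) r, ψ w ∈ D := fun w hw => Function.invFunOn_mem (hr hw)
  have heq : ∀ w ∈ Metric.ball (0 : ℂ) r, f (ψ w) = w := fun w hw => Function.invFunOn_eq (hr hw)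
  refine ⟨ψ, fun w hw => ⟨hmem w hw, heq w hw, ?_⟩, fun z hz hzr => ?_⟩
  · set z := ψ w with hz
    have hzD := hmem w hw
    have hs : HasStrictDerivAt f (deriv f z) z :=
      (hf.differentiableOn.analyticAt (hD.mem_nhds hzD)).hasStrictDerivAt
    have hne := hf.deriv_ne_zero z hzD
    have hinv := (hs.to_localInverse hne).hasDerivAt
    have hfz : f z = w := heq w hw
    have hright : ∀ᶠ v in 𝓝 (f z), f (hs.localInverse f (deriv f z) z hne v) = v :=
      hs.eventually_right_inverse hne
    have hleft : hs.localInverse f (deriv f z) z hne (f z) = z :=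
      (hs.eventually_left_inverse hne).self_of_nhds
    have hmemD : ∀ᶠ v in 𝓝 (f z), hs.localInverse f (deriv f z) z hne v ∈ D := by
      have : Tendsto _ _ _ := hinv.continuousAt
      rw [hleft] at this
      exact this (hD.mem_nhds hzD)
    rw [hfz] at hinv hright hmemD
    refine hinv.congr_of_eventuallyEq ?_
    filter_upwards [hright, hmemD, Metric.isOpen_ball.mem_nhds hw] with v hv1 hv2 hv3
    exact hf.injOn (hmem v hv3) hv2 ((heq v hv3).trans hv1.symm)
  · have hb : f z ∈ Metric.ball (0 : ℂ) r := mem_ball_zero_iff.2 hzr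
    exact hf.injOn (hmem _ hb) hz (heq _ hb)

/-- The distortion estimate at a point, from a Koebe estimate with constant `κ`. -/
theorem sq_sub_norm_sq_le (hf : IsDiskEmbedding D f) (hD : IsOpen D) {r κ : ℝ} (hr0 : 0 < r)
    (hr : Metric.ball 0 r ⊆ f '' D)
    (hκ : HasKoebeConstant D κ) {z c : ℂ} (hz : z ∈ D) (hzr : ‖f z‖ < r) (hc : c ∉ D) :
    r ^ 2 - ‖f z‖ ^ 2 ≤ κ * r * ‖deriv f z‖ * ‖z - c‖ := by
  obtain ⟨ψ, hψ, hψf⟩ := hf.exists_inverse hD hr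
  set b : ℂ := f z / r with hb
  have hrn : ‖(r : ℂ)‖ = r := by rw [Complex.norm_real, Real.norm_of_nonneg hr0.le]
  have hrc : (r : ℂ) ≠ 0 := by exact_mod_cast hr0.ne'
  have hbn : ‖b‖ = ‖f z‖ / r := by rw [hb, norm_div, hrn]
  have hb1 : ‖-b‖ < 1 := by rwa [norm_neg, hbn, div_lt_one hr0]
  have hmem : ∀ ζ ∈ Metric.ball (0 : ℂ) 1, r * diskMobius (-b) ζ ∈ Metric.ball (0 : ℂ) r := by
    intro ζ hζ
    rw [mem_ball_zero_iff, norm_mul, hrn]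
    have := norm_diskMobius_lt_one hb1 (mem_ball_zero_iff.1 hζ)
    nlinarith
  -- The automorphism `diskMobius (-b)` sends `0` to `b = f z / r`, so `k` is univalent into `D`
  -- with `k 0 = z` and `‖k' 0‖ = r * (1 - ‖b‖ ^ 2) / ‖f' z‖`.
  set k : ℂ → ℂ := fun ζ => ψ (r * diskMobius (-b) ζ) with hk
  have hkd : ∀ ζ ∈ Metric.ball (0 : ℂ) 1, HasDerivAt k ((deriv f (k ζ))⁻¹ *
      (r * ((1 - ‖-b‖ ^ 2 : ℝ) / (1 - conj (-b) * ζ) ^ 2))) ζ := fun ζ hζ =>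
    ((hψ _ (hmem ζ hζ)).2.2).comp ζ
      ((hasDerivAt_diskMobius hb1 (mem_ball_zero_iff.1 hζ)).const_mul (r : ℂ))
  have h0m : (0 : ℂ) ∈ Metric.ball (0 : ℂ) 1 := Metric.mem_ball_self one_pos
  have hk0 : k 0 = z := by
    have : (r : ℂ) * diskMobius (-b) 0 = f z := by
      simp only [diskMobius, hb, sub_neg_eq_add, zero_add, mul_zero, sub_zero, div_one]
      field_simp
    simp only [hk, this]
    exact hψf z hz hzr
  have key := hκ k (fun ζ hζ => (hkd ζ hζ).differentiableAt.differentiableWithinAt) ?_ ?_ c hc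
  · rw [(hkd 0 h0m).deriv, hk0, mul_zero, sub_zero, one_pow, div_one, norm_mul, norm_mul, norm_inv,
      hrn, Complex.norm_real, norm_neg, hbn] at key
    have hfz : 0 < ‖deriv f z‖ := norm_pos_iff.2 (hf.deriv_ne_zero z hz)
    have h1 : 0 ≤ 1 - (‖f z‖ / r) ^ 2 := by
      have : ‖f z‖ / r ≤ 1 := by rw [div_le_one hr0]; exact hzr.le
      have : 0 ≤ ‖f z‖ / r := by positivity
      nlinarith
    rw [Real.norm_of_nonneg h1] at key
    have h2 : r ^ 2 - ‖f z‖ ^ 2 = r * ‖deriv f z‖ *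
        (‖deriv f z‖⁻¹ * (r * (1 - (‖f z‖ / r) ^ 2))) := by
      field_simp
    rw [h2]
    calc _ ≤ r * ‖deriv f z‖ * (κ * ‖z - c‖) := by gcongr
      _ = _ := by ring
  · intro ζ hζ ξ hξ h
    have h1 := congrArg f h
    simp only [hk] at h1
    rw [(hψ _ (hmem ζ hζ)).2.1, (hψ _ (hmem ξ hξ)).2.1] at h1
    exact diskMobius_injOn hb1 (mem_ball_zero_iff.1 hζ) (mem_ball_zero_iff.1 hξ)
      (mul_left_cancel₀ hrc h1)
  · exact fun ζ hζ => (hψ _ (hmem ζ hζ)).1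

/-- An embedding with large image is almost symmetric when the domain is symmetric. -/
theorem norm_conj_sub_le (hf : IsDiskEmbedding D f) (hD : IsOpen D)
    (hsymm : ∀ z : ℂ, z ∈ D ↔ conj z ∈ D) (h0 : (0 : ℂ) ∈ D) (hf0 : f 0 = 0)
    (hreal : deriv f 0 = (‖deriv f 0‖ : ℂ)) {r ρ : ℝ} (hr0 : 0 < r) (hr1 : r < 1)
    (hr : Metric.ball 0 r ⊆ f '' D) (hρr : ρ < r) {z : ℂ} (hz : z ∈ D)
    (hzρ : ‖f z‖ ≤ ρ) : ‖conj (f (conj z)) - f z‖ ≤ 2 * (1 / r - 1) / (r - ρ) := by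
  obtain ⟨ψ, hψ, hψf⟩ := hf.exists_inverse hD hr
  have hcd : ∀ z ∈ D, HasDerivAt (fun z => conj (f (conj z))) (conj (deriv f (conj z))) z := by
    intro z hz
    have := (hf.hasDerivAt ((hsymm z).1 hz)).conj_conj
    rw [Complex.conj_conj] at this
    exact this
  have hhd : ∀ w ∈ Metric.ball (0 : ℂ) r, HasDerivAt (fun w => conj (f (conj (ψ w))))
      (conj (deriv f (conj (ψ w))) * (deriv f (ψ w))⁻¹) w := fun w hw =>
    (hcd _ (hψ w hw).1).comp w (hψ w hw).2.2
  have h0m : (0 : ℂ) ∈ Metric.ball (0 : ℂ) r := Metric.mem_ball_self hr0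
  have hψ0 : ψ 0 = 0 := by
    have := hψf 0 h0 (by rwa [hf0, norm_zero])
    rwa [hf0] at this
  -- The reflected map read in the coordinate `w = f z` fixes `0` and has derivative `1` there
  -- because `f' 0` is real, so rigidity applies.
  have key := norm_sub_self_le_of_deriv_eq_one (h := fun w => conj (f (conj (ψ w)))) hr0 hr1
    hρr (fun w hw => (hhd w hw).differentiableAt.differentiableWithinAt) (fun w hw => by
      rw [mem_ball_zero_iff, Complex.norm_conj]
      exact hf.norm_lt_one ((hsymm _).1 (hψ w hw).1)) (by simp [hψ0, hf0]) (by
      rw [(hhd 0 h0m).deriv, hψ0, map_zero, hreal, Complex.conj_ofReal]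
      refine mul_inv_cancel₀ ?_
      exact_mod_cast (norm_pos_iff.2 (hf.deriv_ne_zero 0 h0)).ne') hzρ
  rwa [hψf z hz (hzρ.trans_lt hρr)] at key

end IsDiskEmbedding

/-! ### The distance `δ_D` -/

theorem deltaAt_bddBelow (D : Set ℂ) (z : ℂ) : BddBelow {d : ℝ | ∃ w ∈ Dᶜ, d = ‖z - w‖} :=
  ⟨0, by rintro _ ⟨w, _, rfl⟩; exact norm_nonneg _⟩

theorem deltaAt_set_nonempty {D : Set ℂ} (hne : D ≠ univ) (z : ℂ) :
    {d : ℝ | ∃ w ∈ Dᶜ, d = ‖z - w‖}.Nonempty := by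
  obtain ⟨c, hc⟩ := (ne_univ_iff_exists_notMem D).1 hne
  exact ⟨_, c, hc, rfl⟩

theorem deltaAt_le_deltaDom {D : Set ℂ} (hne : D ≠ univ) {t : ℝ} (ht : t ∈ Icc (-1 : ℝ) 1) :
    deltaAt D t ≤ deltaDom D := by
  obtain ⟨c, hc⟩ := (ne_univ_iff_exists_notMem D).1 hne
  -- One omitted point bounds all the distances, so the `sSup` is a genuine supremum and not the
  -- default `0`.
  refine le_csSup ⟨1 + ‖c‖, ?_⟩ ⟨t, ht, rfl⟩
  rintro _ ⟨x, hx, rfl⟩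
  calc deltaAt D x ≤ ‖(x : ℂ) - c‖ := csInf_le (deltaAt_bddBelow D x) ⟨c, hc, rfl⟩
    _ ≤ ‖(x : ℂ)‖ + ‖c‖ := norm_sub_le _ _
    _ ≤ 1 + ‖c‖ := by
      rw [Complex.norm_real, Real.norm_eq_abs]
      gcongr
      exact abs_le.2 hx

theorem le_mul_deltaDom {D : Set ℂ} (hne : D ≠ univ) {t : ℝ} (ht : t ∈ Icc (-1 : ℝ) 1) {a b : ℝ}
    (hb : 0 < b) (h : ∀ c ∉ D, a ≤ b * ‖(t : ℂ) - c‖) : a ≤ b * deltaDom D := by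
  have h1 : a / b ≤ deltaAt D t := by
    refine le_csInf (deltaAt_set_nonempty hne _) ?_
    rintro _ ⟨c, hc, rfl⟩
    rw [div_le_iff₀' hb]
    exact h c hc
  rw [← div_le_iff₀' hb]
  exact h1.trans (deltaAt_le_deltaDom hne ht)

theorem IsNiceDomain.zero_mem {D : Set ℂ} (hD : IsNiceDomain D) : (0 : ℂ) ∈ D := by
  simpa using hD.segment_subset 0 (by norm_num)

theorem IsNiceDomain.deltaDom_pos {D : Set ℂ} (hD : IsNiceDomain D) : 0 < deltaDom D := by
  obtain ⟨R, hR, hRD⟩ := Metric.isOpen_iff.1 hD.isOpen 0 hD.zero_mem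
  have := le_mul_deltaDom hD.ne_univ (t := 0) (by norm_num) (a := R) one_pos fun c hc => by
    by_contra! hlt
    refine hc (hRD ?_)
    rw [mem_ball_zero_iff]
    simpa using hlt
  linarith

/-! ### Construction of the real map -/

/-- The left side is the total loss from using an embedding covering only the disk of radius `r`; it
is continuous in `r` and vanishes at `r = 1`. -/
theorem exists_radius_of_lt {c C ρ d : ℝ} (hρ0 : 0 ≤ ρ) (hρ : ρ < 1) (hcC : c < C) :
    ∃ r : ℝ, ρ < r ∧ r < 1 ∧
      (1 - r ^ 2 + (2 * (1 / r - 1) / (r - ρ)) ^ 2 / 4) * C / r +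
        2 * (1 / r - 1) / (r - ρ) / (2 * d) < (C - c) * (1 - ρ ^ 2) := by
  have hpos : 0 < (C - c) * (1 - ρ ^ 2) := mul_pos (sub_pos.2 hcC) (by nlinarith)
  have hcont : ContinuousAt (fun r : ℝ =>
      (1 - r ^ 2 + (2 * (1 / r - 1) / (r - ρ)) ^ 2 / 4) * C / r +
        2 * (1 / r - 1) / (r - ρ) / (2 * d)) 1 := by
    have h1 : (1 : ℝ) - ρ ≠ 0 := by linarith
    have h2 : ContinuousAt (fun r : ℝ => 2 * (1 / r - 1) / (r - ρ)) 1 := by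
      refine ContinuousAt.div ?_ (by fun_prop) h1
      exact continuousAt_const.mul ((continuousAt_const.div continuousAt_id one_ne_zero).sub
        continuousAt_const)
    refine ContinuousAt.add (ContinuousAt.div ?_ continuousAt_id one_ne_zero) (h2.div_const _)
    exact (((by fun_prop : ContinuousAt (fun r : ℝ => 1 - r ^ 2) 1).add
      ((h2.pow 2).div_const 4))).mul_const C
  have hlim := hcont.tendsto.eventually_lt_const (u := (C - c) * (1 - ρ ^ 2)) (by
    norm_num
    nlinarith)
  have h3 : ∀ᶠ r in 𝓝[<] (1 : ℝ), r < 1 := self_mem_nhdsWithin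
  have h4 : ∀ᶠ r in 𝓝[<] (1 : ℝ), ρ < r := nhdsWithin_le_nhds (lt_mem_nhds hρ)
  obtain ⟨r, hr1, hr2, hr3⟩ := ((hlim.filter_mono nhdsWithin_le_nhds).and (h3.and h4)).exists
  exact ⟨r, hr3, hr2, hr1⟩

theorem IsNiceDomain.exists_closedBall_subset_compact {D : Set ℂ} (hD : IsNiceDomain D) :
    ∃ d > 0, ∃ K, IsCompact K ∧ K ⊆ D ∧
      ∀ t ∈ Icc (-1 : ℝ) 1, Metric.closedBall (t : ℂ) d ⊆ K := by
  have hI : IsCompact ((fun t : ℝ => (t : ℂ)) '' Icc (-1 : ℝ) 1) :=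
    isCompact_Icc.image Complex.continuous_ofReal
  obtain ⟨d, hd, hsub⟩ := hI.exists_cthickening_subset_open hD.isOpen (by
    rintro _ ⟨t, ht, rfl⟩; exact hD.segment_subset t ht)
  exact ⟨d, hd, _, hI.cthickening, hsub, fun t ht =>
    Metric.closedBall_subset_cthickening (mem_image_of_mem _ ht) d⟩

/-- A real holomorphic map to the disk whose hyperbolic derivative on `[-1,1]` is almost as large
as the Koebe estimate predicts. -/
theorem IsNiceDomain.exists_real_map {D : Set ℂ} (hD : IsNiceDomain D) {κ : ℝ} (hκ0 : 0 < κ)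
    (hκ : HasKoebeConstant D κ) {c : ℝ} (hc : c < 1 / (κ * deltaDom D)) :
    ∃ F : ℂ → ℂ, DifferentiableOn ℂ F D ∧ MapsTo F D (Metric.ball 0 1) ∧
      (∀ t : ℝ, (t : ℂ) ∈ D → (F t).im = 0) ∧
      ∀ t ∈ Icc (-1 : ℝ) 1, c * (1 - (F t).re ^ 2) ≤ |(deriv F t).re| := by
  obtain ⟨d, hd, K, hK, hKD, hdK⟩ := hD.exists_closedBall_subset_compact
  have h0 := hD.zero_mem
  have hδ := hD.deltaDom_pos
  obtain ⟨ρ, hρ1, hρ⟩ := exists_forall_norm_le_on_compact hD.isOpen hD.isConnected.isPreconnected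
    h0 hK hKD
  have hρ0 : 0 ≤ ρ := by
    have h1 := hρ (fun _ => 0) (differentiableOn_const 0)
      (fun _ _ => Metric.mem_ball_self one_pos) rfl 0 (hdK 0 (by norm_num) (by simpa using hd.le))
    simpa using h1
  set C := 1 / (κ * deltaDom D) with hC
  have hC0 : 0 < C := by positivity
  -- `ρ` bounds all normalized maps at once, so `r` may be chosen after `ρ` and before `f`.
  obtain ⟨r, hρr, hr1, hr⟩ := exists_radius_of_lt (d := d) hρ0 hρ1 hc
  have hr0 : 0 < r := hρ0.trans_lt hρr
  set E := 2 * (1 / r - 1) / (r - ρ) with hE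
  obtain ⟨f, hf, hf0, hfr, hfreal⟩ := exists_isDiskEmbedding_ball_subset hD.isOpen
    hD.isSimplyConnected hD.ne_univ h0 hr0 hr1
  have hfK : ∀ z ∈ K, ‖f z‖ ≤ ρ := hρ f hf.differentiableOn hf.mapsTo hf0
  have hcd : ∀ z ∈ D, HasDerivAt (fun z => conj (f (conj z))) (conj (deriv f (conj z))) z := by
    intro z hz
    have := (hf.hasDerivAt ((hD.symmetric z).1 hz)).conj_conj
    rw [Complex.conj_conj] at this
    exact this
  have hEK : ∀ z ∈ K, ‖conj (f (conj z)) - f z‖ ≤ E := fun z hz =>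
    hf.norm_conj_sub_le hD.isOpen hD.symmetric h0 hf0 hfreal hr0 hr1 hfr hρr (hKD hz) (hfK z hz)
  have hFd : ∀ z ∈ D, HasDerivAt (fun z => (f z + conj (f (conj z))) / 2)
      ((deriv f z + conj (deriv f (conj z))) / 2) z := fun z hz =>
    ((hf.hasDerivAt hz).fun_add (hcd z hz)).div_const 2
  have hFt : ∀ t : ℝ, (f t + conj (f (conj (t : ℂ)))) / 2 = ((f t).re : ℂ) := by
    intro t
    rw [Complex.conj_ofReal, Complex.add_conj]
    push_cast
    ring
  refine ⟨fun z => (f z + conj (f (conj z))) / 2,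
    fun z hz => (hFd z hz).differentiableAt.differentiableWithinAt, fun z hz => ?_, fun t _ => ?_,
    fun t ht => ?_⟩
  · rw [mem_ball_zero_iff, norm_div, Complex.norm_ofNat, div_lt_one two_pos]
    have h1 := norm_add_le (f z) (conj (f (conj z)))
    have h2 := hf.norm_lt_one hz
    have h3 := hf.norm_lt_one ((hD.symmetric z).1 hz)
    rw [Complex.norm_conj] at h1
    linarith
  · simp only [hFt, Complex.ofReal_im]
  · have htK : (t : ℂ) ∈ K := hdK t ht (Metric.mem_closedBall_self hd.le)
    have htD := hKD htK
    rw [(hFd t htD).deriv, Complex.conj_ofReal, Complex.add_conj]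
    simp only [hFt, Complex.ofReal_re]
    have h2 : (((2 * (deriv f t).re : ℝ) : ℂ) / 2).re = (deriv f t).re := by
      rw [mul_comm]; push_cast; rw [mul_div_cancel_right₀ _ two_ne_zero, Complex.ofReal_re]
    rw [h2]
    have himf : |(f t).im| ≤ E / 2 := by
      have h3 := hEK t htK
      rw [Complex.conj_ofReal, norm_sub_rev, Complex.sub_conj, norm_mul, Complex.norm_I, mul_one,
        Complex.norm_real, Real.norm_eq_abs, abs_mul, abs_two] at h3
      linarith
    -- Cauchy's estimate on the circle of radius `d`, applied to the asymmetry of `f`, which is at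
    -- most `E` there.
    have himf' : |(deriv f t).im| ≤ E / d / 2 := by
      have h3 := Complex.norm_deriv_le_of_forall_mem_sphere_norm_le (c := (t : ℂ))
        (f := fun z => conj (f (conj z)) - f z) (C := E) hd (by
          refine DifferentiableOn.diffContOnCl fun z hz => ?_
          rw [closure_ball _ hd.ne'] at hz
          have hzD := hKD (hdK t ht hz)
          exact ((hcd z hzD).sub (hf.hasDerivAt hzD)).differentiableAt.differentiableWithinAt)
        fun z hz => hEK z (hdK t ht (Metric.sphere_subset_closedBall hz))
      rw [((hcd t htD).fun_sub (hf.hasDerivAt htD)).deriv, Complex.conj_ofReal, norm_sub_rev,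
        Complex.sub_conj, norm_mul, Complex.norm_I, mul_one, Complex.norm_real, Real.norm_eq_abs,
        abs_mul, abs_two] at h3
      linarith
    have hkoebe : r ^ 2 - ‖f t‖ ^ 2 ≤ κ * r * ‖deriv f t‖ * deltaDom D := by
      refine le_mul_deltaDom hD.ne_univ ht ?_ fun c hcD =>
        hf.sq_sub_norm_sq_le hD.isOpen hr0 hfr hκ htD ((hfK t htK).trans_lt hρr) hcD
      have := norm_pos_iff.2 (hf.deriv_ne_zero t htD)
      positivity
    have hkoebe' : (r ^ 2 - ‖f t‖ ^ 2) * C / r ≤ ‖deriv f t‖ := by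
      rw [hC, mul_one_div, div_div, div_le_iff₀ (by positivity)]
      calc _ ≤ _ := hkoebe
        _ = _ := by ring
    have hnorm : ‖f t‖ ^ 2 = (f t).re ^ 2 + (f t).im ^ 2 := by
      rw [← Complex.normSq_eq_norm_sq, Complex.normSq_apply]; ring
    have him2 : (f t).im ^ 2 ≤ E ^ 2 / 4 := by
      rw [← sq_abs]
      nlinarith [abs_nonneg (f t).im]
    have hre2 : (f t).re ^ 2 ≤ ρ ^ 2 := by
      rw [← sq_abs]
      exact pow_le_pow_left₀ (abs_nonneg _) ((Complex.abs_re_le_norm _).trans (hfK t htK)) 2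
    have hdn : ‖deriv f t‖ ≤ |(deriv f t).re| + |(deriv f t).im| := Complex.norm_le_abs_re_add_abs_im _
    -- Replacing `‖f t‖` by the real part costs `E ^ 2 / 4`, replacing `‖f' t‖` costs `E / (2 * d)`,
    -- and `r < 1` costs `1 - r ^ 2`. By the choice of `r` the sum fits in `(C - c) * (1 - ρ ^ 2)`.
    have h4 : (1 - (f t).re ^ 2) * C ≤ (1 - (f t).re ^ 2) * C / r := by
      rw [le_div_iff₀ hr0]
      have h5 : 0 ≤ (1 - (f t).re ^ 2) * C := mul_nonneg (by nlinarith) hC0.le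
      nlinarith
    have h5 : ((1 - (f t).re ^ 2) - (1 - r ^ 2 + E ^ 2 / 4)) * C / r ≤
        (r ^ 2 - ‖f t‖ ^ 2) * C / r :=
      div_le_div_of_nonneg_right (mul_le_mul_of_nonneg_right (by linarith) hC0.le) hr0.le
    have h6 : ((1 - (f t).re ^ 2) - (1 - r ^ 2 + E ^ 2 / 4)) * C / r =
      (1 - (f t).re ^ 2) * C / r - (1 - r ^ 2 + E ^ 2 / 4) * C / r := by ring
    have h7 : (C - c) * (1 - ρ ^ 2) ≤ (C - c) * (1 - (f t).re ^ 2) := by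
      have := sub_pos.2 hc
      gcongr
    have h8 : E / d / 2 = E / (2 * d) := by rw [div_div, mul_comm d 2]
    rw [h8] at himf'
    nlinarith

/-! ### Pseudo-hyperbolic separation on the segment -/

/-- For `q ≤ p` the right side is `(Y - 1) / (Y + 1)` with `Y = p / q ≥ X`, and this function
increases. -/
theorem div_add_one_le_abs_div_add {p q X : ℝ} (hp : 0 < p) (hq : 0 < q) (hX : 1 ≤ X)
    (h : Real.log X ≤ |Real.log p - Real.log q|) :
    (X - 1) / (X + 1) ≤ |(p - q) / (p + q)| := by
  wlog hpq : q ≤ p generalizing p q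
  · have := this hq hp (by rwa [abs_sub_comm]) (le_of_not_ge hpq)
    rwa [abs_div, abs_sub_comm, add_comm q p, ← abs_div] at this
  have hX0 : 0 < X := by linarith
  rw [abs_of_nonneg (sub_nonneg.2 (Real.log_le_log hq hpq)), ← Real.log_div hp.ne' hq.ne',
    Real.log_le_log_iff hX0 (by positivity), le_div_iff₀ hq] at h
  rw [abs_of_nonneg (div_nonneg (sub_nonneg.2 hpq) (by positivity)),
    div_le_div_iff₀ (by positivity) (by positivity)]
  nlinarith

/-- The function `v = 2 artanh φ` has `|v'| ≥ 2 * c`, so the mean value theorem separates its values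
by `2 * c * ε`. The pseudo-hyperbolic distance is `tanh` of half that separation. -/
theorem exp_sub_one_div_le_abs_pseudo {φ φ' : ℝ → ℝ} {c ε s t : ℝ} (hc : 0 ≤ c) (hε : 0 ≤ ε)
    (hφ : ∀ x ∈ Icc (-1 : ℝ) 1, HasDerivAt φ (φ' x) x) (h1 : ∀ x ∈ Icc (-1 : ℝ) 1, |φ x| < 1)
    (hder : ∀ x ∈ Icc (-1 : ℝ) 1, c * (1 - φ x ^ 2) ≤ |φ' x|) (hs : s ∈ Icc (-1 : ℝ) 1)
    (ht : t ∈ Icc (-1 : ℝ) 1) (hst : ε ≤ |t - s|) :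
    (Real.exp (2 * c * ε) - 1) / (Real.exp (2 * c * ε) + 1) ≤
      |(φ t - φ s) / (1 - φ s * φ t)| := by
  have hm : ∀ x ∈ Icc (-1 : ℝ) 1, 0 < 1 - φ x := fun x hx => by linarith [(abs_lt.1 (h1 x hx)).2]
  have hp : ∀ x ∈ Icc (-1 : ℝ) 1, 0 < 1 + φ x := fun x hx => by linarith [(abs_lt.1 (h1 x hx)).1]
  set v : ℝ → ℝ := fun x => Real.log (1 + φ x) - Real.log (1 - φ x) with hv
  have hvd : ∀ x ∈ Icc (-1 : ℝ) 1, HasDerivAt v (φ' x / (1 + φ x) - -φ' x / (1 - φ x)) x :=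
    fun x hx => (((hφ x hx).const_add 1).log (hp x hx).ne').fun_sub
      (((hφ x hx).const_sub 1).log (hm x hx).ne')
  have hvb : ∀ x ∈ Icc (-1 : ℝ) 1, 2 * c ≤ |φ' x / (1 + φ x) - -φ' x / (1 - φ x)| := by
    intro x hx
    have h2 := hm x hx
    have h3 := hp x hx
    have h4 : φ' x / (1 + φ x) - -φ' x / (1 - φ x) = 2 * φ' x / (1 - φ x ^ 2) := by
      have : 1 - φ x ^ 2 = (1 + φ x) * (1 - φ x) := by ring
      rw [this]
      field_simp
      ring
    have h5 : 0 < 1 - φ x ^ 2 := by nlinarith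
    rw [h4, abs_div, abs_of_pos h5, abs_mul, abs_two, le_div_iff₀ h5]
    linarith [hder x hx]
  have hΔ : ∀ s ∈ Icc (-1 : ℝ) 1, ∀ t ∈ Icc (-1 : ℝ) 1, 2 * c * |t - s| ≤ |v t - v s| := by
    have key : ∀ s ∈ Icc (-1 : ℝ) 1, ∀ t ∈ Icc (-1 : ℝ) 1, s < t →
        2 * c * |t - s| ≤ |v t - v s| := by
      intro s hs t ht hlt
      have hsub : Icc s t ⊆ Icc (-1 : ℝ) 1 := Icc_subset_Icc hs.1 ht.2
      obtain ⟨x, hx, hxe⟩ := exists_hasDerivAt_eq_slope v _ hlt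
        (fun x hx => (hvd x (hsub hx)).continuousAt.continuousWithinAt)
        (fun x hx => hvd x (hsub (Ioo_subset_Icc_self hx)))
      have h2 := hvb x (hsub (Ioo_subset_Icc_self hx))
      rw [hxe, abs_div, le_div_iff₀ (abs_pos.2 (sub_pos.2 hlt).ne')] at h2
      exact h2
    intro s hs t ht
    rcases lt_trichotomy s t with h | h | h
    · exact key s hs t ht h
    · rw [h]; simp
    · have := key t ht s hs h
      rwa [abs_sub_comm t s, abs_sub_comm (v t)]
  have hs1 := hm s hs
  have hs2 := hp s hs
  have ht1 := hm t ht
  have ht2 := hp t ht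
  have hX : 1 ≤ Real.exp (2 * c * ε) := Real.one_le_exp (by positivity)
  have key := div_add_one_le_abs_div_add (div_pos ht2 ht1) (div_pos hs2 hs1) hX (by
    rw [Real.log_exp, Real.log_div ht2.ne' ht1.ne', Real.log_div hs2.ne' hs1.ne']
    refine le_trans ?_ (hΔ s hs t ht)
    gcongr)
  have heq : ((1 + φ t) / (1 - φ t) - (1 + φ s) / (1 - φ s)) /
      ((1 + φ t) / (1 - φ t) + (1 + φ s) / (1 - φ s)) = (φ t - φ s) / (1 - φ s * φ t) := by
    have h2 : (1 + φ t) / (1 - φ t) - (1 + φ s) / (1 - φ s) =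
        2 * (φ t - φ s) / ((1 - φ t) * (1 - φ s)) := by field_simp; ring
    have h3 : (1 + φ t) / (1 - φ t) + (1 + φ s) / (1 - φ s) =
        2 * (1 - φ s * φ t) / ((1 - φ t) * (1 - φ s)) := by field_simp; ring
    rw [h2, h3, div_div_div_cancel_right₀ (mul_pos ht1 hs1).ne', mul_div_mul_left _ _ two_ne_zero]
  rwa [heq] at key

theorem diskMobius_ofReal (a u : ℝ) :
    diskMobius (a : ℂ) (u : ℂ) = (((u - a) / (1 - a * u) : ℝ) : ℂ) := by
  simp [diskMobius]

/-! ### The Blaschke-type competitor -/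

section TestFunction

variable {D : Set ℂ} {F : ℂ → ℂ} {n : ℕ} {x : Fin n → ℝ} {k : Fin n → ℕ}

/-- Each factor vanishes at its node, so the order there is at least `2 * k j`, more than required.
A node must exist because the empty product `1` is not in the open disk. -/
theorem prod_diskMobius_mem_classF (hD : IsOpen D) (hF : DifferentiableOn ℂ F D)
    (hmaps : MapsTo F D (Metric.ball 0 1)) (hx : ∀ j, (x j : ℂ) ∈ D) (hk : ∀ j, 0 < k j)
    (hn : Nonempty (Fin n)) :
    (fun z => ∏ j, diskMobius (F (x j)) (F z) ^ (2 * k j)) ∈ classF D x k := by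
  have hlt : ∀ z ∈ D, ‖F z‖ < 1 := fun z hz => mem_ball_zero_iff.1 (hmaps hz)
  have hmd : ∀ j, DifferentiableOn ℂ (fun z => diskMobius (F (x j)) (F z)) D := fun j z hz =>
    ((hasDerivAt_diskMobius (hlt _ (hx j)) (hlt z hz)).differentiableAt.comp z
      (hF.differentiableAt (hD.mem_nhds hz))).differentiableWithinAt
  have hmp : ∀ j, DifferentiableOn ℂ (fun z => diskMobius (F (x j)) (F z) ^ (2 * k j)) D :=
    fun j => (hmd j).pow _
  have hm1 : ∀ j, ∀ z ∈ D, ‖diskMobius (F (x j)) (F z) ^ (2 * k j)‖ < 1 := fun j z hz => by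
    rw [norm_pow]
    exact pow_lt_one₀ (norm_nonneg _) (norm_diskMobius_lt_one (hlt _ (hx j)) (hlt z hz))
      (by have := hk j; omega)
  refine ⟨DifferentiableOn.fun_finsetProd fun j _ => hmp j, fun z hz => ?_, fun j => ?_⟩
  · rw [mem_ball_zero_iff, norm_prod]
    obtain ⟨i⟩ := hn
    rw [← Finset.mul_prod_erase _ _ (Finset.mem_univ i)]
    refine (mul_le_of_le_one_right (norm_nonneg _) ?_).trans_lt (hm1 i z hz)
    exact Finset.prod_le_one (fun _ _ => norm_nonneg _) fun j _ => (hm1 j z hz).le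
  · have hdec : (fun z => ∏ j, diskMobius (F (x j)) (F z) ^ (2 * k j)) =
        (fun z => diskMobius (F (x j)) (F z)) ^ (2 * k j) *
          fun z => ∏ i ∈ Finset.univ.erase j, diskMobius (F (x i)) (F z) ^ (2 * k i) := by
      funext z
      exact (Finset.mul_prod_erase _ _ (Finset.mem_univ j)).symm
    have hnhds := hD.mem_nhds (hx j)
    have ha1 : AnalyticAt ℂ (fun z => diskMobius (F (x j)) (F z)) (x j) := (hmd j).analyticAt hnhds
    have ha2 : AnalyticAt ℂ (fun z => ∏ i ∈ Finset.univ.erase j,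
        diskMobius (F (x i)) (F z) ^ (2 * k i)) (x j) :=
      (DifferentiableOn.fun_finsetProd fun i _ => hmp i).analyticAt hnhds
    rw [hdec]
    refine (natCast_le_analyticOrderAt_iff_iteratedDeriv_eq_zero ((ha1.pow _).mul ha2)).1 ?_
    rw [analyticOrderAt_mul (ha1.pow _) ha2, analyticOrderAt_pow ha1]
    have h1 : (1 : ℕ∞) ≤ analyticOrderAt (fun z => diskMobius (F (x j)) (F z)) (x j) :=
      Order.one_le_iff_ne_zero.2 (ha1.analyticOrderAt_ne_zero.2 (diskMobius_self _))
    calc (k j : ℕ∞) ≤ (2 * k j : ℕ) := by exact_mod_cast (by omega)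
      _ = (2 * k j) • (1 : ℕ∞) := by simp
      _ ≤ (2 * k j) • analyticOrderAt (fun z => diskMobius (F (x j)) (F z)) (x j) := by gcongr
      _ ≤ _ := le_self_add

theorem prod_diskMobius_ofReal (hreal : ∀ t : ℝ, (t : ℂ) ∈ D → (F t).im = 0)
    (hx : ∀ j, (x j : ℂ) ∈ D) {t : ℝ} (ht : (t : ℂ) ∈ D) :
    ∏ j, diskMobius (F (x j)) (F t) ^ (2 * k j) =
      ((∏ j, (((F t).re - (F (x j)).re) / (1 - (F (x j)).re * (F t).re)) ^ (2 * k j) : ℝ) : ℂ) := by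
  have hre : ∀ t : ℝ, (t : ℂ) ∈ D → F t = ((F t).re : ℂ) := fun t ht =>
    Complex.ext rfl (by rw [hreal t ht, Complex.ofReal_im])
  rw [Complex.ofReal_prod]
  refine Finset.prod_congr rfl fun j _ => ?_
  rw [Complex.ofReal_pow, ← diskMobius_ofReal, ← hre t ht, ← hre _ (hx j)]

theorem prod_diskMobius_mem_classFplus (hD : IsOpen D) (hF : DifferentiableOn ℂ F D)
    (hmaps : MapsTo F D (Metric.ball 0 1)) (hreal : ∀ t : ℝ, (t : ℂ) ∈ D → (F t).im = 0)
    (hx : ∀ j, (x j : ℂ) ∈ D) (hk : ∀ j, 0 < k j) (hn : Nonempty (Fin n)) :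
    (fun z => ∏ j, diskMobius (F (x j)) (F z) ^ (2 * k j)) ∈ classFplus D x k := by
  refine ⟨⟨prod_diskMobius_mem_classF hD hF hmaps hx hk hn, fun t ht => ?_⟩, fun t ht => ?_⟩
  · simp only [prod_diskMobius_ofReal hreal hx ht, Complex.ofReal_im]
  · simp only [prod_diskMobius_ofReal hreal hx ht, Complex.ofReal_re]
    exact Finset.prod_nonneg fun j _ => (even_two_mul _).pow_nonneg _

end TestFunction

/-! ### Bounds for `J₊` and the limit -/

theorem JplusNodes_nonneg (α : Measure ℝ) {D : Set ℂ} {n : ℕ} {x : Fin n → ℝ} {k : Fin n → ℕ} :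
    0 ≤ JplusNodes α D x k := by
  refine Real.sSup_nonneg ?_
  rintro _ ⟨g, _, rfl⟩
  exact norm_nonneg _

theorem Jplus_nodes_nonempty (α : Measure ℝ) (D : Set ℂ) {N : ℕ} (hN : 0 < N) :
    {v : ℝ | ∃ (n : ℕ) (x : Fin n → ℝ) (k : Fin n → ℕ),
      StrictMono x ∧ (∀ j, x j ∈ Icc (-1 : ℝ) 1) ∧ (∀ j, 0 < k j) ∧ ∑ j, k j = N ∧
      v = JplusNodes α D x k}.Nonempty :=
  ⟨_, 1, fun _ => 0, fun _ => N, Subsingleton.strictMono _, fun _ => by norm_num, fun _ => hN,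
    by simp, rfl⟩

section Extremal

variable (α : Measure ℝ) [IsFiniteMeasure α] {D : Set ℂ} {n : ℕ} {x : Fin n → ℝ} {k : Fin n → ℕ}

theorem norm_integral_le_of_mem_classFplus (hseg : ∀ t ∈ Icc (-1 : ℝ) 1, (t : ℂ) ∈ D)
    {g : ℂ → ℂ} (hg : g ∈ classFplus D x k) :
    ‖∫ t in Icc (-1 : ℝ) 1, g (t : ℂ) ∂α‖ ≤ α.real (Icc (-1 : ℝ) 1) := by
  have h := norm_setIntegral_le_of_norm_le_const (μ := α) (s := Icc (-1 : ℝ) 1)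
    (f := fun t : ℝ => g t) (C := 1) (measure_lt_top _ _) fun t ht =>
    (mem_ball_zero_iff.1 (hg.1.1.2.1 (hseg t ht))).le
  rwa [one_mul] at h

theorem JplusNodes_le (hseg : ∀ t ∈ Icc (-1 : ℝ) 1, (t : ℂ) ∈ D) :
    JplusNodes α D x k ≤ α.real (Icc (-1 : ℝ) 1) := by
  refine Real.sSup_le ?_ measureReal_nonneg
  rintro _ ⟨g, hg, rfl⟩
  exact norm_integral_le_of_mem_classFplus α hseg hg

theorem norm_integral_le_JplusNodes (hseg : ∀ t ∈ Icc (-1 : ℝ) 1, (t : ℂ) ∈ D)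
    {g : ℂ → ℂ} (hg : g ∈ classFplus D x k) :
    ‖∫ t in Icc (-1 : ℝ) 1, g (t : ℂ) ∂α‖ ≤ JplusNodes α D x k := by
  refine le_csSup ⟨α.real (Icc (-1 : ℝ) 1), ?_⟩ ⟨g, hg, rfl⟩
  rintro _ ⟨g, hg, rfl⟩
  exact norm_integral_le_of_mem_classFplus α hseg hg

theorem Jplus_le (hseg : ∀ t ∈ Icc (-1 : ℝ) 1, (t : ℂ) ∈ D) {N : ℕ} (hN : 0 < N) :
    Jplus α D N ≤ α.real (Icc (-1 : ℝ) 1) := by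
  obtain ⟨v, hv⟩ := Jplus_nodes_nonempty α D hN
  have hle : Jplus α D N ≤ v := by
    refine csInf_le ⟨0, ?_⟩ hv
    rintro _ ⟨n, x, k, -, -, -, -, rfl⟩
    exact JplusNodes_nonneg α
  obtain ⟨n, x, k, -, -, -, -, rfl⟩ := hv
  exact hle.trans (JplusNodes_le α hseg)

theorem le_modulus {δ : ℝ} {A : Set ℝ} (hA : MeasurableSet A) (hsub : A ⊆ Icc (-1 : ℝ) 1)
    (hvol : volume A ≤ ENNReal.ofReal δ) : α.real A ≤ modulus α δ := by
  refine le_csSup ⟨α.real univ, ?_⟩ ⟨A, hA, hsub, hvol, rfl⟩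
  rintro _ ⟨B, _, _, _, rfl⟩
  exact measureReal_mono (subset_univ _)

/-- The lower bound for given nodes coming from a real map to the disk. -/
theorem le_JplusNodes_of_real_map (hD : IsOpen D) (hseg : ∀ t ∈ Icc (-1 : ℝ) 1, (t : ℂ) ∈ D)
    {F : ℂ → ℂ} (hF : DifferentiableOn ℂ F D) (hmaps : MapsTo F D (Metric.ball 0 1))
    (hreal : ∀ t : ℝ, (t : ℂ) ∈ D → (F t).im = 0) {c ε : ℝ} (hc : 0 ≤ c) (hε : 0 < ε)
    (hder : ∀ t ∈ Icc (-1 : ℝ) 1, c * (1 - (F t).re ^ 2) ≤ |(deriv F t).re|)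
    {N : ℕ} (hN : 0 < N) (hx : ∀ j, x j ∈ Icc (-1 : ℝ) 1) (hk : ∀ j, 0 < k j)
    (hsum : ∑ j, k j = N) :
    ((Real.exp (2 * c * ε) - 1) / (Real.exp (2 * c * ε) + 1)) ^ (2 * N) *
      (α.real (Icc (-1 : ℝ) 1) - modulus α (2 * N * ε)) ≤ JplusNodes α D x k := by
  have hxD : ∀ j, (x j : ℂ) ∈ D := fun j => hseg _ (hx j)
  have hn : Nonempty (Fin n) := by
    by_contra h
    rw [not_nonempty_iff] at h
    rw [Finset.univ_eq_empty, Finset.sum_empty] at hsum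
    omega
  set T := (Real.exp (2 * c * ε) - 1) / (Real.exp (2 * c * ε) + 1) with hT
  have hT0 : 0 ≤ T := div_nonneg (sub_nonneg.2 (Real.one_le_exp (by positivity))) (by positivity)
  set γ : ℝ → ℝ := fun t =>
    ∏ j, (((F t).re - (F (x j)).re) / (1 - (F (x j)).re * (F t).re)) ^ (2 * k j) with hγ
  have hγ0 : ∀ t, 0 ≤ γ t := fun t => Finset.prod_nonneg fun j _ => (even_two_mul _).pow_nonneg _
  have hmem := prod_diskMobius_mem_classFplus hD hF hmaps hreal hxD hk hn
  set g : ℂ → ℂ := fun z => ∏ j, diskMobius (F (x j)) (F z) ^ (2 * k j) with hg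
  have hgγ : ∀ t ∈ Icc (-1 : ℝ) 1, g t = (γ t : ℂ) := fun t ht =>
    prod_diskMobius_ofReal hreal hxD (hseg t ht)
  have hgc : ContinuousOn (fun t : ℝ => g t) (Icc (-1 : ℝ) 1) :=
    hmem.1.1.1.continuousOn.comp Complex.continuous_ofReal.continuousOn hseg
  have hγi : IntegrableOn γ (Icc (-1 : ℝ) 1) α := by
    have hc : ContinuousOn γ (Icc (-1 : ℝ) 1) :=
      (Complex.continuous_re.comp_continuousOn hgc).congr fun t ht => by
        rw [Function.comp_apply, hgγ t ht, Complex.ofReal_re]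
    exact hc.integrableOn_compact isCompact_Icc
  have hint : ‖∫ t in Icc (-1 : ℝ) 1, g t ∂α‖ = ∫ t in Icc (-1 : ℝ) 1, γ t ∂α := by
    rw [setIntegral_congr_fun measurableSet_Icc hgγ, integral_complex_ofReal, Complex.norm_real,
      Real.norm_of_nonneg (integral_nonneg fun t => hγ0 t)]
  refine le_trans ?_ (norm_integral_le_JplusNodes α hseg hmem)
  rw [hint]
  have hφ : ∀ t ∈ Icc (-1 : ℝ) 1, HasDerivAt (fun t : ℝ => (F t).re) (deriv F t).re t :=
    fun t ht => (hF.differentiableAt (hD.mem_nhds (hseg t ht))).hasDerivAt.real_of_complex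
  have hφ1 : ∀ t ∈ Icc (-1 : ℝ) 1, |(F t).re| < 1 := fun t ht =>
    (Complex.abs_re_le_norm _).trans_lt (mem_ball_zero_iff.1 (hmaps (hseg t ht)))
  -- The exceptional set consists of `n` intervals of length `2 * ε`, and `n ≤ N` since
  -- multiplicities are positive.
  set A : Set ℝ := Icc (-1 : ℝ) 1 ∩ ⋃ j, Ioo (x j - ε) (x j + ε) with hA
  have hAm : MeasurableSet A :=
    measurableSet_Icc.inter (MeasurableSet.iUnion fun j => measurableSet_Ioo)
  have hAvol : volume A ≤ ENNReal.ofReal (2 * N * ε) := by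
    have hnN : n ≤ N := by
      rw [← hsum]
      calc n = ∑ _j : Fin n, 1 := by simp
        _ ≤ ∑ j, k j := Finset.sum_le_sum fun j _ => hk j
    calc volume A ≤ volume (⋃ j, Ioo (x j - ε) (x j + ε)) := measure_mono inter_subset_right
      _ ≤ ∑ j, volume (Ioo (x j - ε) (x j + ε)) := measure_iUnion_fintype_le _ _
      _ = ∑ _j : Fin n, ENNReal.ofReal (2 * ε) := by
          refine Finset.sum_congr rfl fun j _ => ?_
          rw [Real.volume_Ioo]
          congr 1
          ring
      _ = ENNReal.ofReal (n * (2 * ε)) := by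
          rw [Finset.sum_const, Finset.card_univ, Fintype.card_fin, nsmul_eq_mul,
            ENNReal.ofReal_mul (Nat.cast_nonneg n), ENNReal.ofReal_natCast]
      _ ≤ ENNReal.ofReal (2 * N * ε) := by
          refine ENNReal.ofReal_le_ofReal ?_
          have : (n : ℝ) ≤ N := by exact_mod_cast hnN
          nlinarith
  have hmod := le_modulus α hAm inter_subset_left hAvol
  have hlow : ∀ t ∈ Icc (-1 : ℝ) 1 \ A, T ^ (2 * N) ≤ γ t := by
    rintro t ⟨ht, htA⟩
    have hfar : ∀ j, ε ≤ |t - x j| := by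
      intro j
      by_contra! hlt
      refine htA ⟨ht, mem_iUnion.2 ⟨j, ?_⟩⟩
      rw [abs_lt] at hlt
      exact ⟨by linarith, by linarith⟩
    rw [← hsum, Finset.mul_sum, ← Finset.prod_pow_eq_pow_sum]
    refine Finset.prod_le_prod (fun j _ => pow_nonneg hT0 _) fun j _ => ?_
    exact (pow_le_pow_left₀ hT0 (exp_sub_one_div_le_abs_pseudo hc hε.le hφ hφ1 hder (hx j) ht
      (hfar j)) _).trans_eq ((even_two_mul (k j)).pow_abs _)
  -- Only `α.real A ≤ modulus` and `0 ≤ T` enter, so the difference on the left may have either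
  -- sign.
  calc T ^ (2 * N) * (α.real (Icc (-1 : ℝ) 1) - modulus α (2 * N * ε))
      ≤ T ^ (2 * N) * (α.real (Icc (-1 : ℝ) 1) - α.real A) := by gcongr
    _ = T ^ (2 * N) * α.real (Icc (-1 : ℝ) 1 \ A) := by
        rw [measureReal_sdiff inter_subset_left hAm]
    _ ≤ ∫ t in Icc (-1 : ℝ) 1 \ A, γ t ∂α :=
        setIntegral_ge_of_const_le_real (measurableSet_Icc.diff hAm) (measure_ne_top _ _) hlow
          (hγi.mono_set sdiff_subset)
    _ ≤ ∫ t in Icc (-1 : ℝ) 1, γ t ∂α :=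
        setIntegral_mono_set hγi (Eventually.of_forall hγ0) sdiff_subset.eventuallyLE

theorem IsNiceDomain.le_Jplus (hD : IsNiceDomain D) {κ : ℝ} (hκ0 : 0 < κ)
    (hκ : HasKoebeConstant D κ) {N : ℕ} (hN : 0 < N) {ε : ℝ} (hε : 0 < ε) :
    ((Real.exp (2 * (1 / κ) * ε / deltaDom D) - 1) /
        (Real.exp (2 * (1 / κ) * ε / deltaDom D) + 1)) ^ (2 * N) *
      (α.real (Icc (-1 : ℝ) 1) - modulus α (2 * N * ε)) ≤ Jplus α D N := by
  refine le_csInf (Jplus_nodes_nonempty α D hN) ?_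
  rintro _ ⟨n, x, k, -, hx, hk, hsum, rfl⟩
  have hδ := hD.deltaDom_pos
  set C := 1 / (κ * deltaDom D) with hC
  have hC0 : 0 < C := by positivity
  have hCε : 2 * (1 / κ) * ε / deltaDom D = 2 * C * ε := by
    rw [hC]; field_simp
  rw [hCε]
  have hcont : ContinuousAt (fun c : ℝ =>
      ((Real.exp (2 * c * ε) - 1) / (Real.exp (2 * c * ε) + 1)) ^ (2 * N) *
      (α.real (Icc (-1 : ℝ) 1) - modulus α (2 * N * ε))) C := by
    have h1 : Real.exp (2 * C * ε) + 1 ≠ 0 := by positivity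
    have h2 : ContinuousAt (fun c : ℝ =>
        (Real.exp (2 * c * ε) - 1) / (Real.exp (2 * c * ε) + 1)) C :=
      ContinuousAt.div (by fun_prop) (by fun_prop) h1
    exact (h2.pow _).mul_const _
  -- Real maps are available only for `c < C`; continuity in `c` gives the bound at `C`.
  refine le_of_tendsto (hcont.tendsto.mono_left (nhdsWithin_le_nhds (s := Iio C))) ?_
  have h3 : ∀ᶠ c in 𝓝[<] C, c < C := self_mem_nhdsWithin
  have h4 : ∀ᶠ c in 𝓝[<] C, 0 < c := nhdsWithin_le_nhds (lt_mem_nhds hC0)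
  filter_upwards [h3, h4] with c hcC hc0
  obtain ⟨F, hF, hmaps, hreal, hder⟩ := hD.exists_real_map hκ0 hκ hcC
  exact le_JplusNodes_of_real_map α hD.isOpen hD.segment_subset hF hmaps hreal hc0.le hε hder hN hx
    hk hsum

/-- Absolute continuity of the integral of the Radon–Nikodym density. -/
theorem exists_modulus_le (hac : α ≪ volume) {η : ℝ} (hη : 0 < η) :
    ∃ δ > 0, modulus α δ ≤ η := by
  obtain ⟨δ, hδ, hb⟩ := exists_pos_setLIntegral_lt_of_measure_lt (μ := volume)
    (f := α.rnDeriv volume) (Measure.lintegral_rnDeriv_lt_top α volume).ne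
    (ε := ENNReal.ofReal η) (by simpa using hη)
  obtain ⟨r, hr0, hrδ⟩ := ENNReal.lt_iff_exists_real_btwn.1 hδ |>.imp fun r h => h
  refine ⟨r, ?_, Real.sSup_le ?_ hη.le⟩
  · simpa using hrδ.1
  · rintro _ ⟨A, hA, _, hvol, rfl⟩
    have h1 := hb A (hvol.trans_lt hrδ.2)
    rw [Measure.setLIntegral_rnDeriv hac] at h1
    exact ENNReal.toReal_le_of_le_ofReal hη.le h1.le

/-- The `comap` filter on the type of all domains expresses uniformity: its neighbourhoods depend on
`δ_D` alone. -/
theorem tendsto_Jplus (hac : α ≪ volume) {N : ℕ} (hN : 0 < N) :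
    Tendsto (fun D : {D : Set ℂ // IsNiceDomain D} => Jplus α D.1 N)
      (comap (fun D : {D : Set ℂ // IsNiceDomain D} => deltaDom D.1) (𝓝 0))
      (𝓝 (α.real (Icc (-1 : ℝ) 1))) := by
  refine tendsto_order.2 ⟨fun a ha => ?_, fun a ha => Eventually.of_forall fun D =>
    (Jplus_le α D.2.segment_subset hN).trans_lt ha⟩
  obtain ⟨δ, hδ, hmod⟩ := exists_modulus_le α hac (half_pos (sub_pos.2 ha))
  have hN' : (0 : ℝ) < N := by exact_mod_cast hN
  -- With `ε` fixed so that `2 * N * ε = δ`, the modulus takes at most half of the gap to `a`, while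
  -- the `tanh` factor tends to `1` as `δ_D → 0`.
  set ε := δ / (2 * N) with hε
  have hε0 : 0 < ε := by positivity
  have hNε : 2 * N * ε = δ := by rw [hε]; field_simp
  have hdelta : Tendsto (fun D : {D : Set ℂ // IsNiceDomain D} => deltaDom D.1)
      (comap (fun D : {D : Set ℂ // IsNiceDomain D} => deltaDom D.1) (𝓝 0)) (𝓝[>] 0) :=
    tendsto_nhdsWithin_iff.2 ⟨tendsto_comap, Eventually.of_forall fun D => D.2.deltaDom_pos⟩
  have hT : Tendsto (fun y : ℝ => (Real.exp y - 1) / (Real.exp y + 1)) atTop (𝓝 1) := by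
    have h1 : Tendsto (fun y : ℝ => 1 - 2 / (Real.exp y + 1)) atTop (𝓝 (1 - 0)) :=
      tendsto_const_nhds.sub (tendsto_const_nhds.div_atTop
        (tendsto_atTop_add_const_right _ _ Real.tendsto_exp_atTop))
    rw [sub_zero] at h1
    refine h1.congr fun y => ?_
    have : Real.exp y + 1 ≠ 0 := by positivity
    field_simp
    ring
  have harg : Tendsto (fun d : ℝ => 2 * (1 / 4) * ε / d) (𝓝[>] 0) atTop := by
    simp only [div_eq_mul_inv]
    exact tendsto_inv_nhdsGT_zero.const_mul_atTop (by positivity)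
  have hlim := ((hT.comp (harg.comp hdelta)).pow (2 * N)).mul_const
    (α.real (Icc (-1 : ℝ) 1) - modulus α (2 * N * ε))
  rw [one_pow, one_mul] at hlim
  have ha' : a < α.real (Icc (-1 : ℝ) 1) - modulus α (2 * N * ε) := by
    rw [hNε]; linarith
  filter_upwards [hlim.eventually_const_lt ha'] with D hDa
  exact hDa.trans_le (D.2.le_Jplus α (by norm_num) (hasKoebeConstant_four D.1) hN hε0)

theorem IsNiceDomain.lowerBoundSet_bounds (hD : IsNiceDomain D) {κ : ℝ} (hκ0 : 0 < κ)
    (hκ : HasKoebeConstant D κ) {N : ℕ} (hN : 0 < N) :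
    BddAbove (lowerBoundSet (1 / κ) α D N) ∧ sSup (lowerBoundSet (1 / κ) α D N) ≤ Jplus α D N := by
  have h : ∀ v ∈ lowerBoundSet (1 / κ) α D N, v ≤ Jplus α D N := by
    rintro _ ⟨ε, hε, rfl⟩
    exact hD.le_Jplus α hκ0 hκ hN hε
  exact ⟨⟨_, h⟩, csSup_le ⟨_, 1, one_pos, rfl⟩ h⟩

end Extremal

theorem mainTheorem4 (α : Measure ℝ) [IsFiniteMeasure α] (hac : α ≪ volume)
    (hsupp : α (Icc (-1 : ℝ) 1)ᶜ = 0) (N : ℕ) (hN : 0 < N) :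
    (∀ D : Set ℂ, IsNiceDomain D →
      (BddAbove (lowerBoundSet (1 / 4) α D N) ∧
        sSup (lowerBoundSet (1 / 4) α D N) ≤ Jplus α D N) ∧
      (Convex ℝ D →
        BddAbove (lowerBoundSet (1 / 2) α D N) ∧
          sSup (lowerBoundSet (1 / 2) α D N) ≤ Jplus α D N)) ∧
    Tendsto (fun D : {D : Set ℂ // IsNiceDomain D} => Jplus α D.1 N)
      (comap (fun D : {D : Set ℂ // IsNiceDomain D} => deltaDom D.1) (𝓝 0))
      (𝓝 (α.real (Icc (-1 : ℝ) 1))) :=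
  ⟨fun D hD => ⟨hD.lowerBoundSet_bounds α (by norm_num) (hasKoebeConstant_four D) hN,
    fun hconv => hD.lowerBoundSet_bounds α (by norm_num) (hasKoebeConstant_two hD.isOpen hconv) hN⟩,
    tendsto_Jplus α hac hN⟩
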